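/- Let $M\subset\mathbb C^{n+1}$ be a real-analytic real hypersurface through $0$ which near $0$ is given by $w=Q(z,\bar Z)$, $Z=(z,w)\in\mathbb C^n\times\mathbb C$, where $Q=Q(z,\bar\zeta)$ is holomorphic in $(z,\bar\zeta)$ on an open neighborhood $D$ of $0$ in $\mathbb C^n\times\mathbb C^{n+1}$. Suppose that $M$ is transversally holomorphically embeddable into a real hyperquadric $M'\subset\mathbb C^{n+m+1}$: $M'$ is given in some linear coordinates $(z',w')\in\mathbb C^{n+m}\times\mathbb C$ by $\operatorname{Im}w'=h(z',\bar z')$ with $h$ a hermitian form, and there is a holomorphic embedding $H$ of a neighborhood of $M$ into $\mathbb C^{n+m+1}$ with $H(M)\subset M'$ and $H_*(T_x\mathbb C^{n+1})+T_{H(x)}M'=T_{H(x)}\mathbb C^{n+m+1}$ for all $x\in M$. For $\zeta\in\mathbb C^{n+1}$ let $S_\zeta=\{(z,w):(z,\bar\zeta)\in D,\ w=Q(z,\bar\zeta)\}$ be the Segre variety. Fix a proper subset $I\subsetneq\{1,\dots,n\}$, put $V_I=(\operatorname{span}_{\mathbb C}\{e_j:j\in I\}\times\mathbb C)\cap T^c_0M$,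 where $e_1,\dots,e_n$ is the standard basis of $\mathbb C^n$ and $T^c_0M=T_0M\cap iT_0M$, and $$S_{0,V_I}=\{\zeta\in S_0:\ T_0S_\zeta\supset V_I\}.$$ Let $\alpha_1,\dots,\alpha_{m+1}\in\mathbb N^n$ be multiindices with $|\alpha_j|=2$ and $\operatorname{supp}\alpha_j=\{i:(\alpha_j)_i\neq0\}\subset I$. Then there are $(\lambda_1,\dots,\lambda_{m+1})\in\mathbb C^{m+1}\setminus\{0\}$ and a polynomial $R_1$ in $n$ variables with complex coefficients, of degree at most $1$, such that $$\sum_{j=1}^{m+1}\lambda_j\,Q_{z^{\alpha_j}}(0,\bar\zeta)=R_1\big(Q_{z_1}(0,\bar\zeta),\dots,Q_{z_n}(0,\bar\zeta)\big)$$ for all $\zeta\in S_{0,V_I}$ sufficiently close to $0$, and, with the same $\lambda_j$ and $R_1$, for all $\zeta$ in every connected complex submanifold of $\mathbb C^{n+1}$ that contains $0$ and is contained in $S_{0,V_I}$ (in particular on all of $S_{0,V_I}$ whenever $S_{0,V_I}$ is itself a connected complex submanifold). -/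

import Mathlib

open Set Filter Topology
open scoped Pointwise

namespace SegreRelation

/-- `ℂⁿ⁺¹` with coordinates `Z = (z, w)`, `z ∈ ℂⁿ`, `w ∈ ℂ`.  The conjugate `Z̄` is `star Z`. -/
abbrev Space (n : ℕ) : Type := (Fin n → ℂ) × ℂ

/-- The real tangent space at `p` of a (sub)manifold `M`, as the set of all velocity vectors
at `p` of curves that stay in `M`.  It is empty if `p ∉ M`. -/
def tangentVectors {E : Type*} [NormedAddCommGroup E] [NormedSpace ℝ E]
    (M : Set E) (p : E) : Set E :=
  {v | ∃ γ : ℝ → E, γ 0 = p ∧ HasDerivAt γ v 0 ∧ ∀ᶠ t in 𝓝 (0 : ℝ), γ t ∈ M}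

/-- The complex tangent space `T^c_p M = T_p M ∩ i T_p M`. -/
def complexTangentVectors {E : Type*} [NormedAddCommGroup E] [NormedSpace ℂ E]
    (M : Set E) (p : E) : Set E :=
  tangentVectors M p ∩ Complex.I • tangentVectors M p

/-- `M` is a real-analytic real hypersurface: near each of its points it is the zero set of a
real-valued real-analytic function with nonvanishing differential at that point. -/
def IsRealAnalyticHypersurface {E : Type*} [NormedAddCommGroup E] [NormedSpace ℝ E]
    (M : Set E) : Prop :=
  ∀ p ∈ M, ∃ U : Set E, IsOpen U ∧ p ∈ U ∧ ∃ ρ : E → ℝ, AnalyticOnNhd ℝ ρ U ∧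
    fderiv ℝ ρ p ≠ 0 ∧ ∀ x ∈ U, (x ∈ M ↔ ρ x = 0)

/-- `M'` is a real hyperquadric in `ℂᴺ⁺¹`: in some linear coordinates `(z, w) ∈ ℂᴺ × ℂ` it is
given by `Im w = h(z, z̄)`, where `h` is a (possibly degenerate) hermitian form. -/
def IsRealHyperquadric {N : ℕ} (M' : Set (Fin (N + 1) → ℂ)) : Prop :=
  ∃ (L : (Fin (N + 1) → ℂ) ≃ₗ[ℂ] (Fin N → ℂ) × ℂ) (A : Matrix (Fin N) (Fin N) ℂ),
    A.IsHermitian ∧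
      M' = {x | (((L x).2.im : ℝ) : ℂ) = star (L x).1 ⬝ᵥ A.mulVec (L x).1}

/-- `H` is a holomorphic embedding of the open set `O`: it is holomorphic, an immersion, and a
homeomorphism onto its image. -/
structure IsHolomorphicEmbeddingOn {E F : Type*} [NormedAddCommGroup E] [NormedSpace ℂ E]
    [NormedAddCommGroup F] [NormedSpace ℂ F] (H : E → F) (O : Set E) : Prop where
  differentiableOn : DifferentiableOn ℂ H O
  immersion : ∀ x ∈ O, Function.Injective (fderiv ℂ H x)
  isEmbedding : IsEmbedding (O.domRestrict H)

/-- `M` is transversally holomorphically embeddable into `M'`: some holomorphic embedding `H` of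
a neighborhood of `M` maps `M` into `M'` and satisfies
`H_* (T_x E) + T_{H(x)} M' = T_{H(x)} F` for all `x ∈ M`. -/
def TransversallyEmbeddable {E F : Type*} [NormedAddCommGroup E] [NormedSpace ℂ E]
    [NormedAddCommGroup F] [NormedSpace ℂ F] (M : Set E) (M' : Set F) : Prop :=
  ∃ (O : Set E) (H : E → F), IsOpen O ∧ M ⊆ O ∧ IsHolomorphicEmbeddingOn H O ∧
    MapsTo H M M' ∧
    ∀ x ∈ M, range (fderiv ℂ H x) + tangentVectors M' (H x) = univ

/-- Near `0`, the set `M` is given by `w = Q(z, Z̄)`, where `Q = Q(z, ζ̄)` is holomorphic on the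
open neighborhood `D` of `0` in `ℂⁿ × ℂⁿ⁺¹`. -/
structure IsGivenBy {n : ℕ} (M : Set (Space n)) (D : Set ((Fin n → ℂ) × Space n))
    (Q : (Fin n → ℂ) × Space n → ℂ) : Prop where
  isOpen : IsOpen D
  zero_mem : 0 ∈ D
  differentiableOn : DifferentiableOn ℂ Q D
  mem_iff : ∀ᶠ Z : Space n in 𝓝 0, (Z ∈ M ↔ Z.2 = Q (Z.1, star Z))

/-- The Segre variety `S_ζ = {(z, w) : w = Q(z, ζ̄)}`. -/
def segre {n : ℕ} (D : Set ((Fin n → ℂ) × Space n)) (Q : (Fin n → ℂ) × Space n → ℂ)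
    (ζ : Space n) : Set (Space n) :=
  {Z | (Z.1, star ζ) ∈ D ∧ Z.2 = Q (Z.1, star ζ)}

/-- `S_{0,V} = {ζ ∈ S_0 : T_0 S_ζ ⊇ V}`. -/
def segreSub {n : ℕ} (D : Set ((Fin n → ℂ) × Space n)) (Q : (Fin n → ℂ) × Space n → ℂ)
    (V : Set (Space n)) : Set (Space n) :=
  {ζ | ζ ∈ segre D Q 0 ∧ V ⊆ tangentVectors (segre D Q ζ) 0}

/-- `V_I = (V⁰_I × ℂ) ∩ T^c_0 M`, where `V⁰_I = span {e_j : j ∈ I}`. -/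
def subspaceV {n : ℕ} (M : Set (Space n)) (I : Set (Fin n)) : Set (Space n) :=
  ((Submodule.span ℂ ((fun j : Fin n => (Pi.single j 1 : Fin n → ℂ)) '' I) :
      Set (Fin n → ℂ)) ×ˢ (univ : Set ℂ)) ∩ complexTangentVectors M 0

/-- The complex partial derivative `∂f / ∂z_i`. -/
noncomputable def pderivC {n : ℕ} (i : Fin n) (f : (Fin n → ℂ) → ℂ) : (Fin n → ℂ) → ℂ :=
  fun z => lineDeriv ℂ f z (Pi.single i 1)

/-- The derivative `∂^{|α|} f / ∂z_1^{α_1} ⋯ ∂z_n^{α_n}` for a multiindex `α`. -/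
noncomputable def multiDeriv {n : ℕ} (α : Fin n → ℕ) (f : (Fin n → ℂ) → ℂ) :
    (Fin n → ℂ) → ℂ :=
  (List.finRange n).foldr (fun i g => (pderivC i)^[α i] g) f

/-- `Q_{z^α}(0, ζ̄)`. -/
noncomputable def derivQ {n : ℕ} (Q : (Fin n → ℂ) × Space n → ℂ) (α : Fin n → ℕ)
    (ζ : Space n) : ℂ :=
  multiDeriv α (fun z => Q (z, star ζ)) 0

/-- `N` is an embedded complex submanifold: around each of its points there is a biholomorphic
chart of the ambient space in which `N` becomes a complex linear subspace. -/
def IsComplexSubmanifold {E : Type*} [NormedAddCommGroup E] [NormedSpace ℂ E]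
    (N : Set E) : Prop :=
  ∀ p ∈ N, ∃ (e : OpenPartialHomeomorph E E) (K : Submodule ℂ E), p ∈ e.source ∧
    DifferentiableOn ℂ e e.source ∧ DifferentiableOn ℂ e.symm e.target ∧
    ∀ x ∈ e.source, (x ∈ N ↔ e x ∈ K)

end SegreRelation

/-! Write the embedding in the linear coordinates of the hyperquadric as `Φ = (f, g)`, so that Im g
= f* A f on M. The points (z, Z̄) with Z ∈ M form a maximally totally real set, so the equation
polarizes (`eqOn_zero_of_totallyReal`, `exists_segre_identity`): near 0, the linear functional
θ_ζ(x, y) = y - 2i f(ζ)* A x (`segreForm`) is constant, equal to the conjugate of g(ζ), along the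
image under `Φ` of the Segre variety w = Q(z, ζ̄).

When Q(0, ζ̄) = 0, differentiating at z = 0 (`segreForm_fderiv_eq_zero`) shows that θ_ζ kills the
vectors DΦ(e_i, Q_{z_i}) and the second derivatives D²Φ(e_a, Q_{z_a})(e_b, Q_{z_b}) + Q_{z_a z_b}
Φ_w, where Q is differentiated at (0, ζ̄). On S_{0,V_I} the slopes Q_{z_j}, j ∈ I, keep their values
q_j from ζ = 0 (`of_mem_segreSub`), so for a, b ∈ I the D²Φ term does not depend on ζ.

At ζ = 0 this places n vectors p_i = DΦ(e_i, q_i), independent since `Φ` is an immersion, and m + 1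
second-order vectors β_j in ker θ_0, which has dimension only n + m. Hence ∑ λ_j β_j = ∑ μ_i p_i
with λ ≠ 0 (`exists_relation`). Applying θ_ζ to this fixed relation, each term is θ_ζ(Φ_w) times the
change of a derivative of Q between ζ and 0. Transversality gives θ_0(Φ_w) ≠ 0, so for ζ near 0 this
factor cancels and an affine relation remains (`exists_relation_near_zero`). It is antiholomorphic
in ζ, so it propagates along connected complex submanifolds (`IsComplexSubmanifold.eqOn_zero`). -/

namespace SegreRelation

/-! ### Holomorphic maps on normed spaces: regularity of derivatives and identity theorems. -/

section ComplexAnalysis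

variable {E W : Type*} [NormedAddCommGroup E] [NormedSpace ℂ E]
  [NormedAddCommGroup W] [NormedSpace ℂ W]

theorem hasDerivAt_line (x v : E) (t : ℂ) : HasDerivAt (fun t : ℂ => x + t • v) v t := by
  simpa using ((hasDerivAt_id t).smul_const v).const_add x

theorem hasDerivAt_comp_line {f : E → W} {x v : E} {t : ℂ}
    (hf : DifferentiableAt ℂ f (x + t • v)) :
    HasDerivAt (fun t : ℂ => f (x + t • v)) (fderiv ℂ f (x + t • v) v) t :=
  hf.hasFDerivAt.comp_hasDerivAt t (hasDerivAt_line x v t)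

/-- Cauchy's estimate for the Fréchet derivative. -/
theorem norm_fderiv_le_of_forall_mem_closedBall {f : E → W} {U : Set E} (hU : IsOpen U)
    (hf : DifferentiableOn ℂ f U) {x : E} {r C : ℝ} (hr : 0 < r)
    (hsub : Metric.closedBall x r ⊆ U) (hC : ∀ y ∈ Metric.closedBall x r, ‖f y‖ ≤ C) :
    ‖fderiv ℂ f x‖ ≤ C / r := by
  have hC0 : 0 ≤ C := (norm_nonneg _).trans (hC x (Metric.mem_closedBall_self hr.le))
  refine ContinuousLinearMap.opNorm_le_bound _ (by positivity) fun v => ?_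
  rcases eq_or_ne v 0 with rfl | hv
  · simp
  have hv' : 0 < ‖v‖ := norm_pos_iff.mpr hv
  have hmem : ∀ t ∈ Metric.closedBall (0 : ℂ) (r / ‖v‖), x + t • v ∈ Metric.closedBall x r := by
    intro t ht
    rw [mem_closedBall_zero_iff, le_div_iff₀ hv'] at ht
    simpa [norm_smul] using ht
  have hder : ∀ t ∈ Metric.closedBall (0 : ℂ) (r / ‖v‖),
      HasDerivAt (fun t : ℂ => f (x + t • v)) (fderiv ℂ f (x + t • v) v) t := fun t ht =>
    hasDerivAt_comp_line (hf.differentiableAt (hU.mem_nhds (hsub (hmem t ht))))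
  have hd : DiffContOnCl ℂ (fun t : ℂ => f (x + t • v)) (Metric.ball 0 (r / ‖v‖)) := by
    apply DifferentiableOn.diffContOnCl
    rw [closure_ball _ (by positivity)]
    exact fun t ht => (hder t ht).differentiableAt.differentiableWithinAt
  have h := Complex.norm_deriv_le_of_forall_mem_sphere_norm_le (by positivity) hd
    fun t ht => hC _ (hmem t (Metric.sphere_subset_closedBall ht))
  rw [(hder 0 (Metric.mem_closedBall_self (by positivity))).deriv] at h
  simp only [zero_smul, add_zero] at h
  calc _ ≤ _ := h
    _ = C / r * ‖v‖ := by field_simp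

/-- Around each point, a holomorphic map and its derivative are bounded. -/
theorem exists_bound_fderiv {f : E → W} {U : Set E} (hU : IsOpen U)
    (hf : DifferentiableOn ℂ f U) {x : E} (hx : x ∈ U) :
    ∃ r > 0, ∃ C, Metric.ball x r ⊆ U ∧ ∀ y ∈ Metric.ball x r, ‖fderiv ℂ f y‖ ≤ C := by
  have hb : ∀ᶠ y in 𝓝 x, ‖f y‖ < ‖f x‖ + 1 :=
    (hf.differentiableAt (hU.mem_nhds hx)).continuousAt.norm.eventually_lt continuousAt_const
      (by simp)
  obtain ⟨r, hr, hsub⟩ := Metric.eventually_nhds_iff_ball.mp (hb.and (hU.mem_nhds hx))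
  refine ⟨r / 2, by positivity, (‖f x‖ + 1) / (r / 4),
    fun y hy => (hsub y (Metric.ball_subset_ball (by linarith) hy)).2, fun y hy => ?_⟩
  have hcb : Metric.closedBall y (r / 4) ⊆ Metric.ball x r := by
    intro z hz
    rw [Metric.mem_ball] at hy ⊢
    rw [Metric.mem_closedBall] at hz
    linarith [dist_triangle z y x]
  exact norm_fderiv_le_of_forall_mem_closedBall hU hf (by positivity)
    (fun z hz => (hsub z (hcb hz)).2) fun z hz => (hsub z (hcb hz)).1.le

/-- Cauchy's estimate is applied to the difference z ↦ f(z + h) - f(z). The mean value inequality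
bounds this difference by C‖h‖, so its derivative at x is O(‖h‖). -/
theorem continuousOn_fderiv {f : E → W} {U : Set E} (hU : IsOpen U)
    (hf : DifferentiableOn ℂ f U) : ContinuousOn (fderiv ℂ f) U := by
  intro x hx
  refine ContinuousAt.continuousWithinAt ?_
  obtain ⟨r, hr, C, hsub, hC⟩ := exists_bound_fderiv hU hf hx
  have hC0 : 0 ≤ C := (norm_nonneg _).trans (hC x (Metric.mem_ball_self hr))
  have key : ∀ᶠ y in 𝓝 x, ‖fderiv ℂ f y - fderiv ℂ f x‖ ≤ (C / (r / 4)) * ‖y - x‖ := by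
    filter_upwards [Metric.ball_mem_nhds x (show 0 < r / 4 by positivity)] with y hy
    rw [mem_ball_iff_norm] at hy
    set h := y - x with hh
    have hy' : y = x + h := by simp [hh]
    have hin : ∀ z ∈ Metric.ball x (r / 2), z ∈ Metric.ball x r ∧ z + h ∈ Metric.ball x r := by
      intro z hz
      rw [mem_ball_iff_norm] at hz ⊢
      rw [mem_ball_iff_norm]
      refine ⟨by linarith, ?_⟩
      have : ‖z + h - x‖ ≤ ‖z - x‖ + ‖h‖ := by
        rw [show z + h - x = (z - x) + h by abel]; exact norm_add_le _ _
      linarith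
    have hd1 : ∀ z ∈ Metric.ball x r, DifferentiableAt ℂ f z := fun z hz =>
      hf.differentiableAt (hU.mem_nhds (hsub hz))
    have hg : DifferentiableOn ℂ (fun z => f (z + h) - f z) (Metric.ball x (r / 2)) := by
      intro z hz
      refine DifferentiableAt.differentiableWithinAt (DifferentiableAt.sub ?_ (hd1 z (hin z hz).1))
      exact (hd1 _ (hin z hz).2).comp z (differentiableAt_id.add_const h)
    have hsub' : Metric.closedBall x (r / 4) ⊆ Metric.ball x (r / 2) :=
      Metric.closedBall_subset_ball (by linarith)
    have hest := norm_fderiv_le_of_forall_mem_closedBall Metric.isOpen_ball hg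
      (show 0 < r / 4 by positivity) hsub' (C := C * ‖h‖) (by
        intro z hz
        have hz' := hin z (hsub' hz)
        have := (convex_ball x r).norm_image_sub_le_of_norm_fderiv_le hd1 hC hz'.1 hz'.2
        simpa using this)
    have hx2 : x ∈ Metric.ball x (r / 2) := Metric.mem_ball_self (by positivity)
    have heq : fderiv ℂ (fun z => f (z + h) - f z) x = fderiv ℂ f y - fderiv ℂ f x := by
      rw [fderiv_fun_sub ((differentiableAt_comp_add_right h).mpr (hd1 _ (hin x hx2).2))
        (hd1 x (hin x hx2).1), fderiv_comp_add_right, hy']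
    rw [heq] at hest
    calc _ ≤ _ := hest
      _ = _ := by ring
  rw [ContinuousAt, tendsto_iff_norm_sub_tendsto_zero]
  refine squeeze_zero' (Eventually.of_forall fun _ => norm_nonneg _) key ?_
  have : ContinuousAt (fun y => (C / (r / 4)) * ‖y - x‖) x := by fun_prop
  simpa [ContinuousAt] using this

/-- The directional derivatives of a holomorphic map are holomorphic. -/
theorem differentiableOn_fderiv_apply [CompleteSpace W] {f : E → W} {U : Set E} (hU : IsOpen U)
    (hf : DifferentiableOn ℂ f U) (v : E) : DifferentiableOn ℂ (fun x => fderiv ℂ f x v) U := by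
  intro x hx
  refine DifferentiableAt.differentiableWithinAt ?_
  obtain ⟨r, hr, C, hsub, hC⟩ := exists_bound_fderiv hU hf hx
  have hC0 : 0 ≤ C := (norm_nonneg _).trans (hC x (Metric.mem_ball_self hr))
  obtain ⟨R, hR, hRv⟩ : ∃ R : ℝ, 0 < R ∧ R * ‖v‖ < r / 2 := by
    refine ⟨r / (2 * (‖v‖ + 1)) , by positivity, ?_⟩
    rw [div_mul_eq_mul_div, div_lt_div_iff₀ (by positivity) (by positivity)]
    nlinarith [norm_nonneg v]
  have hin : ∀ y ∈ Metric.ball x (r / 2), ∀ t : ℂ, ‖t‖ ≤ R → y + t • v ∈ Metric.ball x r := by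
    intro y hy t ht
    rw [mem_ball_iff_norm] at hy ⊢
    have h1 : ‖y + t • v - x‖ ≤ ‖y - x‖ + ‖t‖ * ‖v‖ := by
      rw [show y + t • v - x = (y - x) + t • v by abel, ← norm_smul]; exact norm_add_le _ _
    have h2 := mul_le_mul_of_nonneg_right ht (norm_nonneg v)
    linarith
  have hd : ∀ z ∈ Metric.ball x r, DifferentiableAt ℂ f z := fun z hz =>
    hf.differentiableAt (hU.mem_nhds (hsub hz))
  -- Cauchy's kernel 1/t² for a first derivative, on the circle of radius R and in the form in which
  -- `circleIntegral` unfolds. Differentiation under the integral sign then proves the claim.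
  set k : ℝ → ℂ := fun θ => deriv (circleMap 0 R) θ * (1 / (circleMap 0 R θ - 0) ^ (1 + 1)) with hk
  have hcn : ∀ θ, ‖circleMap 0 R θ‖ = R := fun θ => by simp [abs_of_pos hR]
  have hc0 : ∀ θ, circleMap 0 R θ ≠ 0 := fun θ => by
    rw [← norm_pos_iff, hcn]; exact hR
  have hkc : Continuous k := by
    refine Continuous.mul (f := fun θ => deriv (circleMap 0 R) θ)
      (by simp_rw [deriv_circleMap]; fun_prop) ?_
    exact continuous_const.div (((continuous_circleMap 0 R).sub continuous_const).pow _)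
      fun θ => pow_ne_zero _ (by simpa using hc0 θ)
  have hform : ∀ y ∈ Metric.ball x (r / 2), fderiv ℂ f y v =
      (2 * (Real.pi : ℂ) * Complex.I)⁻¹ •
        ∫ θ in (0 : ℝ)..(2 * Real.pi), k θ • f (y + circleMap 0 R θ • v) := by
    intro y hy
    have hder : ∀ t ∈ Metric.closedBall (0 : ℂ) R,
        HasDerivAt (fun t : ℂ => f (y + t • v)) (fderiv ℂ f (y + t • v) v) t := fun t ht =>
      hasDerivAt_comp_line (hd _ (hin y hy t (by simpa using ht)))
    have hdc : DiffContOnCl ℂ (fun t : ℂ => f (y + t • v)) (Metric.ball 0 R) := by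
      apply DifferentiableOn.diffContOnCl
      rw [closure_ball _ hR.ne']
      exact fun t ht => (hder t ht).differentiableAt.differentiableWithinAt
    have h := hdc.circleIntegral_one_div_sub_center_pow_smul hR 1
    rw [iteratedDeriv_one, (hder 0 (Metric.mem_closedBall_self hR.le)).deriv, circleIntegral] at h
    simp only [zero_smul, add_zero, smul_smul, Nat.factorial_one, Nat.cast_one, div_one] at h
    rw [h, inv_smul_smul₀ (by simp [Real.pi_ne_zero])]
  have hcont : ∀ y ∈ Metric.ball x (r / 2),
      Continuous fun θ : ℝ => k θ • f (y + circleMap 0 R θ • v) := by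
    intro y hy
    refine hkc.smul (continuous_iff_continuousAt.mpr fun θ => ?_)
    exact (hd _ (hin y hy _ (hcn θ).le)).continuousAt.comp
      (f := fun θ : ℝ => y + circleMap 0 R θ • v) (by fun_prop)
  have hcont' : Continuous fun θ : ℝ => k θ • fderiv ℂ f (x + circleMap 0 R θ • v) := by
    refine hkc.smul (continuous_iff_continuousAt.mpr fun θ => ?_)
    have hm := hsub (hin x (Metric.mem_ball_self (by positivity)) _ (hcn θ).le)
    exact ((continuousOn_fderiv hU hf).continuousAt (hU.mem_nhds hm)).comp
      (f := fun θ : ℝ => x + circleMap 0 R θ • v) (by fun_prop)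
  have hball : Metric.ball x (r / 2) ∈ 𝓝 x := Metric.ball_mem_nhds x (by positivity)
  have hint := intervalIntegral.hasFDerivAt_integral_of_dominated_of_fderiv_le
    (μ := MeasureTheory.volume) (a := 0) (b := 2 * Real.pi) (𝕜 := ℂ)
    (F := fun y θ => k θ • f (y + circleMap 0 R θ • v))
    (F' := fun y θ => k θ • fderiv ℂ f (y + circleMap 0 R θ • v))
    (bound := fun θ => ‖k θ‖ * C) (x₀ := x) hball
    (by filter_upwards [hball] with y hy using (hcont y hy).aestronglyMeasurable)
    ((hcont x (Metric.mem_ball_self (by positivity))).intervalIntegrable _ _)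
    hcont'.aestronglyMeasurable
    (Eventually.of_forall fun θ _ y hy => by
      rw [norm_smul]
      exact mul_le_mul_of_nonneg_left (hC _ (hin y hy _ (hcn θ).le)) (norm_nonneg _))
    ((hkc.norm.mul continuous_const).intervalIntegrable _ _)
    (Eventually.of_forall fun θ _ y hy => by
      refine HasFDerivAt.const_smul ?_ (k θ)
      have := (hd _ (hin y hy _ (hcn θ).le)).hasFDerivAt
      exact (hasFDerivAt_comp_add_right _).mpr this)
  refine (hint.differentiableAt.const_smul ((2 * (Real.pi : ℂ) * Complex.I)⁻¹)).congr_of_eventuallyEq ?_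
  filter_upwards [hball] with y hy using hform y hy

theorem differentiableOn_fderiv [FiniteDimensional ℂ E] [CompleteSpace W] {f : E → W} {U : Set E}
    (hU : IsOpen U) (hf : DifferentiableOn ℂ f U) : DifferentiableOn ℂ (fderiv ℂ f) U := by
  let b := Module.finBasis ℂ E
  have h : fderiv ℂ f = fun x => ∑ i, ((LinearMap.toContinuousLinearMap (b.coord i)).smulRight
      (fderiv ℂ f x (b i)) : E →L[ℂ] W) := by
    funext x
    ext v
    conv_lhs => rw [← b.sum_repr v]
    simp [-Module.Basis.sum_repr]
  rw [h]
  refine DifferentiableOn.fun_sum fun i _ => ?_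
  exact (ContinuousLinearMap.smulRightL ℂ E W
    (LinearMap.toContinuousLinearMap (b.coord i))).differentiable.comp_differentiableOn
      (differentiableOn_fderiv_apply hU hf (b i))

/-- The iterated directional derivatives of a map. -/
noncomputable def iterDirDeriv (v : E) (f : E → W) : ℕ → E → W
  | 0 => f
  | k + 1 => fun x => fderiv ℂ (iterDirDeriv v f k) x v

/-- A map holomorphic on a ball, all of whose directional derivatives at the center vanish,
vanishes. -/
theorem eqOn_zero_of_iterDirDeriv_eq_zero [CompleteSpace W] {f : E → W} {r : ℝ}
    (hf : DifferentiableOn ℂ f (Metric.ball 0 r))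
    (h0 : ∀ v k, iterDirDeriv v f k 0 = 0) : ∀ x ∈ Metric.ball 0 r, f x = 0 := by
  intro v hv
  rcases eq_or_ne v 0 with rfl | hv0
  · exact h0 0 0
  have hv' : 0 < ‖v‖ := norm_pos_iff.mpr hv0
  have hdiff : ∀ k, DifferentiableOn ℂ (iterDirDeriv v f k) (Metric.ball 0 r) := by
    intro k
    induction k with
    | zero => exact hf
    | succ k ih => exact differentiableOn_fderiv_apply Metric.isOpen_ball ih v
  have hmem : ∀ t ∈ Metric.ball (0 : ℂ) (r / ‖v‖), 0 + t • v ∈ Metric.ball (0 : E) r := by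
    intro t ht
    rw [mem_ball_zero_iff, lt_div_iff₀ hv'] at ht
    simpa [norm_smul] using ht
  have hder : ∀ k, ∀ t ∈ Metric.ball (0 : ℂ) (r / ‖v‖),
      HasDerivAt (fun t : ℂ => iterDirDeriv v f k (0 + t • v))
        (iterDirDeriv v f (k + 1) (0 + t • v)) t := fun k t ht =>
    hasDerivAt_comp_line ((hdiff k).differentiableAt (Metric.isOpen_ball.mem_nhds (hmem t ht)))
  have hiter : ∀ k, ∀ t ∈ Metric.ball (0 : ℂ) (r / ‖v‖),
      iteratedDeriv k (fun t : ℂ => f (0 + t • v)) t = iterDirDeriv v f k (0 + t • v) := by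
    intro k
    induction k with
    | zero => intro t _; simp [iterDirDeriv]
    | succ k ih =>
      intro t ht
      rw [iteratedDeriv_succ, ← (hder k t ht).deriv]
      refine Filter.EventuallyEq.deriv_eq ?_
      filter_upwards [Metric.isOpen_ball.mem_nhds ht] with s hs using ih s hs
  have hrpos : 0 < r := lt_of_le_of_lt (norm_nonneg v) (by simpa using hv)
  have h1 : (1 : ℂ) ∈ Metric.ball (0 : ℂ) (r / ‖v‖) := by
    rw [mem_ball_zero_iff, lt_div_iff₀ hv']
    simpa using hv
  -- The Taylor series on the complex line through 0 and v is evaluated at t = 1, where the line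
  -- reaches v.
  have hs := Complex.hasSum_taylorSeries_on_ball
    (f := fun t : ℂ => f (0 + t • v)) (c := 0) (r := r / ‖v‖)
    (fun t ht => (hder 0 t ht).differentiableAt.differentiableWithinAt) h1
  have hz : ∀ k, iteratedDeriv k (fun t : ℂ => f (0 + t • v)) 0 = 0 := by
    intro k
    rw [hiter k 0 (Metric.mem_ball_self (by positivity))]
    simpa using h0 v k
  simp only [hz, smul_zero] at hs
  simpa using hs.unique hasSum_zero

/-- The identity theorem on a convex open set. -/
theorem eqOn_zero_of_convex [CompleteSpace W] {f : E → W} {U : Set E} (hU : IsOpen U)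
    (hconv : Convex ℝ U) (hf : DifferentiableOn ℂ f U) {x₀ : E} (hx₀ : x₀ ∈ U)
    (h0 : ∀ᶠ x in 𝓝 x₀, f x = 0) : ∀ x ∈ U, f x = 0 := by
  intro x hx
  -- Restriction to the complex line through the two points reduces to one variable; the preimage of
  -- a convex set is convex, hence connected.
  set φ : ℂ → E := fun t => x₀ + t • (x - x₀) with hφ
  have hφc : Continuous φ := by fun_prop
  have hV : IsOpen (φ ⁻¹' U) := hU.preimage hφc
  have hVc : Convex ℝ (φ ⁻¹' U) := by
    intro s hs t ht a b ha hb hab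
    have := hconv hs ht ha hb hab
    have e : φ (a • s + b • t) = a • φ s + b • φ t := by
      simp only [hφ, smul_add, add_smul, smul_assoc]
      rw [show a • x₀ + a • s • (x - x₀) + (b • x₀ + b • t • (x - x₀))
        = (a + b) • x₀ + (a • s • (x - x₀) + b • t • (x - x₀)) by rw [add_smul]; abel, hab, one_smul]
    rwa [mem_preimage, e]
  have hd : DifferentiableOn ℂ (f ∘ φ) (φ ⁻¹' U) := fun t ht =>
    (hasDerivAt_comp_line (hf.differentiableAt (hU.mem_nhds ht))).differentiableAt.differentiableWithinAt
  have h0V : (0 : ℂ) ∈ φ ⁻¹' U := by simpa [hφ] using hx₀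
  have h1V : (1 : ℂ) ∈ φ ⁻¹' U := by simpa [hφ] using hx
  have hev : (f ∘ φ) =ᶠ[𝓝 0] 0 := by
    have : Tendsto φ (𝓝 0) (𝓝 x₀) := by
      have := hφc.tendsto 0
      simpa [hφ] using this
    exact this.eventually h0
  have := (hd.analyticOnNhd hV).eqOn_zero_of_preconnected_of_eventuallyEq_zero
    hVc.isPreconnected h0V hev h1V
  simpa [hφ] using this

end ComplexAnalysis

/-! ### Tangent vectors of real hypersurfaces. -/

theorem hasFDerivAt_apply_eq_zero_of_tangent {E W : Type*} [NormedAddCommGroup E]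
    [NormedSpace ℝ E] [NormedAddCommGroup W] [NormedSpace ℝ W] {M : Set E} {p v : E}
    (hv : v ∈ tangentVectors M p) {F : E → W} {F' : E →L[ℝ] W} (hF : HasFDerivAt F F' p) {c : W}
    (hc : ∀ᶠ x in 𝓝 p, x ∈ M → F x = c) : F' v = 0 := by
  obtain ⟨γ, h0, hγ, hM⟩ := hv
  subst h0
  have h1 := hF.comp_hasDerivAt 0 hγ
  have h2 : F ∘ γ =ᶠ[𝓝 0] fun _ => c := by
    filter_upwards [hM, hγ.continuousAt.eventually hc] with t ht ht' using ht' ht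
  exact h1.unique ((hasDerivAt_const (0 : ℝ) c).congr_of_eventuallyEq h2)

/-- The tangent space of a hypersurface contains the kernel of the differential of a defining
function. -/
theorem IsRealAnalyticHypersurface.exists_functional {E : Type*} [NormedAddCommGroup E]
    [NormedSpace ℝ E] [CompleteSpace E] {M : Set E} (hM : IsRealAnalyticHypersurface M) {p : E}
    (hp : p ∈ M) : ∃ r : E →L[ℝ] ℝ, r ≠ 0 ∧ ∀ v, r v = 0 → v ∈ tangentVectors M p := by
  obtain ⟨U, hU, hpU, ρ, hρ, hne, hmem⟩ := hM p hp
  refine ⟨fderiv ℝ ρ p, hne, fun v hv => ?_⟩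
  have hs : HasStrictFDerivAt ρ (fderiv ℝ ρ p) p := (hρ p hpU).hasStrictFDerivAt
  have hr : (fderiv ℝ ρ p).range = ⊤ := by
    rw [LinearMap.range_eq_top]
    refine LinearMap.surjective fun h => hne ?_
    ext x
    exact LinearMap.congr_fun h x
  have hp0 : ρ p = 0 := (hmem p hpU).mp hp
  let k : (fderiv ℝ ρ p).ker := ⟨v, hv⟩
  -- The implicit function parametrizes the level set of ρ by the kernel of its differential; γ is
  -- the image of the line in direction v.
  let γ : ℝ → E := fun t => hs.implicitFunction ρ (fderiv ℝ ρ p) hr (ρ p) (t • k)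
  have hlin : HasDerivAt (fun t : ℝ => t • k) k 0 := by
    simpa using (hasDerivAt_id (0 : ℝ)).smul_const k
  have hγ0 : γ 0 = p := by simp [γ]
  have hγ : HasDerivAt γ v 0 := by
    have h := (hs.to_implicitFunction hr).hasFDerivAt
    rw [← zero_smul ℝ k] at h
    exact h.comp_hasDerivAt (0 : ℝ) hlin
  refine ⟨γ, hγ0, hγ, ?_⟩
  have h1 : Tendsto (fun t : ℝ => (ρ p, t • k)) (𝓝 0) (𝓝 (ρ p, 0)) := by
    have := hlin.continuousAt.tendsto
    rw [zero_smul] at this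
    exact tendsto_const_nhds.prodMk_nhds this
  have h2 : ∀ᶠ t in 𝓝 (0 : ℝ), γ t ∈ U :=
    hγ.continuousAt.eventually (by rw [hγ0]; exact hU.mem_nhds hpU)
  filter_upwards [h1.eventually (hs.map_implicitFunction_eq hr), h2] with t ht htU
  rw [hmem _ htU, ← hp0]
  exact ht

/-! ### The maximally totally real set of points (z, Z̄), Z ∈ M. -/

variable {n : ℕ}

/-- The embedding `Z ↦ (z, Z̄)` of the points of `ℂⁿ⁺¹` into the domain of `Q`. -/
noncomputable def conjGraph (n : ℕ) : Space n →L[ℝ] (Fin n → ℂ) × Space n :=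
  (ContinuousLinearMap.fst ℝ (Fin n → ℂ) ℂ).prod
    ((starL' ℝ : Space n ≃L[ℝ] Space n) : Space n →L[ℝ] Space n)

@[simp] theorem conjGraph_apply (Z : Space n) : conjGraph n Z = (Z.1, star Z) := rfl

theorem norm_conjGraph (Z : Space n) : ‖conjGraph n Z‖ = ‖Z‖ := by
  simp [Prod.norm_def]

theorem fderiv_conjGraph_eq_zero {W : Type*} [NormedAddCommGroup W] [NormedSpace ℂ W]
    {M : Set (Space n)} {p v : Space n} (hv : v ∈ tangentVectors M p)
    {f : (Fin n → ℂ) × Space n → W} (hf : DifferentiableAt ℂ f (conjGraph n p))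
    (h0 : ∀ᶠ Z in 𝓝 p, Z ∈ M → f (conjGraph n Z) = 0) :
    fderiv ℂ f (conjGraph n p) (conjGraph n v) = 0 := by
  have h1 := (hf.hasFDerivAt.restrictScalars ℝ).comp p (conjGraph n).hasFDerivAt
  exact hasFDerivAt_apply_eq_zero_of_tangent hv h1 h0

theorem snd_eq_fderiv_of_tangent {M : Set (Space n)} {p v : Space n}
    (hv : v ∈ tangentVectors M p) {Q : (Fin n → ℂ) × Space n → ℂ}
    (hQ : DifferentiableAt ℂ Q (conjGraph n p))
    (h0 : ∀ᶠ Z in 𝓝 p, Z ∈ M → Z.2 = Q (conjGraph n Z)) :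
    v.2 = fderiv ℂ Q (conjGraph n p) (conjGraph n v) := by
  have h1 := (hQ.hasFDerivAt.restrictScalars ℝ).comp p (conjGraph n).hasFDerivAt
  have h2 := (ContinuousLinearMap.snd ℝ (Fin n → ℂ) ℂ).hasFDerivAt (x := p)
  have h3 := hasFDerivAt_apply_eq_zero_of_tangent hv (h2.sub h1) (c := 0)
    (by filter_upwards [h0] with Z hZ hM using sub_eq_zero.mpr (hZ hM))
  exact sub_eq_zero.mp h3

/-- The complex linear functional with real part `r`. -/
theorem exists_complex_functional {E : Type*} [AddCommGroup E] [Module ℂ E] [Module ℝ E]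
    [IsScalarTower ℝ ℂ E] (r : E →ₗ[ℝ] ℝ) : ∃ R : E →ₗ[ℂ] ℂ, ∀ v, (R v).re = r v := by
  refine ⟨Module.Dual.extendRCLike r, fun v => ?_⟩
  exact Module.Dual.re_extendRCLike_apply (𝕜 := ℂ) r v

/-- A hypersurface of the form `w = Q(z, Z̄)` has a tangent space which contains the complex
hyperplane of the zeros of some functional that does not vanish on the `w` direction. -/
theorem exists_complex_tangent {M : Set (Space n)} (hM : IsRealAnalyticHypersurface M)
    {p : Space n} (hp : p ∈ M) {Q : (Fin n → ℂ) × Space n → ℂ}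
    (hQ : DifferentiableAt ℂ Q (conjGraph n p))
    (h0 : ∀ᶠ Z in 𝓝 p, Z ∈ M → Z.2 = Q (conjGraph n Z)) :
    ∃ R : Space n →ₗ[ℂ] ℂ, R (0, 1) = 1 ∧
      ∃ c : ℂ, c ≠ 0 ∧ ∀ v, (c * R v).re = 0 → v ∈ tangentVectors M p := by
  obtain ⟨r, -, hr⟩ := hM.exists_functional hp
  obtain ⟨R, hR⟩ := exists_complex_functional (r : Space n →ₗ[ℝ] ℝ)
  -- Otherwise (0, 1) and (0, i) are both tangent. The equation w = Q(z, Z̄) is antilinear in such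
  -- vectors to first order, which would give i = -i.
  have hR0 : R (0, 1) ≠ 0 := by
    intro h
    have h1 : r ((0, 1) : Space n) = 0 := by
      have := hR (0, 1)
      rw [h] at this
      exact this.symm
    have h2 : r ((0, Complex.I) : Space n) = 0 := by
      have e : ((0, Complex.I) : Space n) = Complex.I • (0, 1) := by simp
      have := hR (0, Complex.I)
      rw [e, map_smul, h, smul_zero] at this
      rw [e]
      exact this.symm
    have e1 := snd_eq_fderiv_of_tangent (hr _ h1) hQ h0
    have e2 := snd_eq_fderiv_of_tangent (hr _ h2) hQ h0
    have e3 : conjGraph n (0, Complex.I) = (-Complex.I) • conjGraph n (0, 1) := by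
      ext <;> simp
    rw [e3, map_smul, ← e1] at e2
    have := congrArg Complex.im e2
    norm_num at this
  refine ⟨(R (0, 1))⁻¹ • R, by simp [hR0], R (0, 1), hR0, fun v hv => hr v ?_⟩
  rw [← ContinuousLinearMap.coe_coe, ← hR v, ← hv]
  simp [hR0]

/-- A holomorphic function vanishing on the totally real set `{(z, Z̄) : Z ∈ M}` has vanishing
differential there. -/
theorem fderiv_eq_zero_of_totallyReal {W : Type*} [NormedAddCommGroup W] [NormedSpace ℂ W]
    {M : Set (Space n)} (hM : IsRealAnalyticHypersurface M)
    {p : Space n} (hp : p ∈ M) {Q : (Fin n → ℂ) × Space n → ℂ}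
    (hQ : DifferentiableAt ℂ Q (conjGraph n p))
    (h0 : ∀ᶠ Z in 𝓝 p, Z ∈ M → Z.2 = Q (conjGraph n Z))
    {f : (Fin n → ℂ) × Space n → W} (hf : DifferentiableAt ℂ f (conjGraph n p))
    (hf0 : ∀ᶠ Z in 𝓝 p, Z ∈ M → f (conjGraph n Z) = 0) :
    fderiv ℂ f (conjGraph n p) = 0 := by
  obtain ⟨R, hR1, c, hc, hR⟩ := exists_complex_tangent hM hp hQ h0
  set ℓ := fderiv ℂ f (conjGraph n p)
  have hT : ∀ v, (c * R v).re = 0 → ℓ (conjGraph n v) = 0 := fun v hv =>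
    fderiv_conjGraph_eq_zero (hR v hv) hf hf0
  -- For v in the complex tangent hyperplane both v and iv are tangent, and their images in (z, Z̄)
  -- are the sum and i times the difference of (v.1, 0) and (0, v̄).
  have hsplit : ∀ v, R v = 0 → ℓ (v.1, 0) = 0 ∧ ℓ (0, star v) = 0 := by
    intro v hv
    have h1 := hT v (by simp [hv])
    have h2 := hT (Complex.I • v) (by simp [hv])
    have e1 : conjGraph n v = (v.1, 0) + (0, star v) := by simp
    have e2 : conjGraph n (Complex.I • v) =
        Complex.I • (((v.1, 0) : (Fin n → ℂ) × Space n) - (0, star v)) := by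
      simp
    rw [e1, map_add] at h1
    rw [e2, map_smul, smul_eq_zero_iff_right Complex.I_ne_zero, map_sub] at h2
    have h3 : ℓ (v.1, 0) = ℓ (0, star v) := sub_eq_zero.mp h2
    rw [h3, ← two_smul ℂ, smul_eq_zero_iff_right two_ne_zero] at h1
    exact ⟨h3.trans h1, h1⟩
  have hz : ∀ z : Fin n → ℂ, ℓ (z, 0) = 0 := by
    intro z
    refine (hsplit (z, - R (z, 0)) ?_).1
    have : ((z, - R (z, 0)) : Space n) = (z, 0) - R (z, 0) • (0, 1) := by simp
    rw [this, map_sub, map_smul, hR1]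
    simp
  -- The remaining real tangent direction: this multiple of the w direction makes c * R v equal to
  -- i, so its real part vanishes although R v ≠ 0.
  have hu : ℓ (0, star ((0, Complex.I * c⁻¹) : Space n)) = 0 := by
    have e : ((0, Complex.I * c⁻¹) : Space n) = (Complex.I * c⁻¹) • (0, 1) := by simp
    have h1 := hT (0, Complex.I * c⁻¹) (by
      rw [e, map_smul, hR1]
      have : c * ((Complex.I * c⁻¹) • (1 : ℂ)) = Complex.I := by
        rw [smul_eq_mul]; field_simp
      rw [this, Complex.I_re])
    simpa using h1
  have hξ : ∀ ξ : Space n, ℓ (0, ξ) = 0 := by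
    intro ξ
    set s := R (star ξ) * (Complex.I * c⁻¹)⁻¹
    have hI : Complex.I * c⁻¹ ≠ 0 := mul_ne_zero Complex.I_ne_zero (inv_ne_zero hc)
    have h1 := (hsplit (star ξ - s • (0, Complex.I * c⁻¹)) (by
      have e : ((0, Complex.I * c⁻¹) : Space n) = (Complex.I * c⁻¹) • (0, 1) := by simp
      rw [map_sub, map_smul, e, map_smul, hR1, smul_eq_mul, smul_eq_mul, mul_one,
        inv_mul_cancel_right₀ hI, sub_self])).2
    have e : ((0, star (star ξ - s • ((0, Complex.I * c⁻¹) : Space n))) : (Fin n → ℂ) × Space n)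
        = (0, ξ) - star s • (0, star ((0, Complex.I * c⁻¹) : Space n)) := by
      rw [star_sub, star_smul, star_star]
      ext <;> simp
    rw [e, map_sub, map_smul, hu, smul_zero, sub_zero] at h1
    exact h1
  refine ContinuousLinearMap.ext fun x => ?_
  have : x = (x.1, 0) + (0, x.2) := by simp
  rw [this, map_add, hz, hξ]
  simp

/-- A holomorphic function vanishing on `{(z, Z̄) : Z ∈ M}` vanishes. -/
theorem eqOn_zero_of_totallyReal {W : Type*} [NormedAddCommGroup W] [NormedSpace ℂ W]
    [CompleteSpace W] {M : Set (Space n)} (hM : IsRealAnalyticHypersurface M) (h0M : 0 ∈ M)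
    {Q : (Fin n → ℂ) × Space n → ℂ} {δ : ℝ} (hδ : 0 < δ)
    (hQ : DifferentiableOn ℂ Q (Metric.ball 0 δ))
    (h0 : ∀ Z ∈ Metric.ball (0 : Space n) δ, Z ∈ M → Z.2 = Q (conjGraph n Z))
    {f : (Fin n → ℂ) × Space n → W} (hf : DifferentiableOn ℂ f (Metric.ball 0 δ))
    (hf0 : ∀ Z ∈ Metric.ball (0 : Space n) δ, Z ∈ M → f (conjGraph n Z) = 0) :
    ∀ x ∈ Metric.ball 0 δ, f x = 0 := by
  have hmem : ∀ Z ∈ Metric.ball (0 : Space n) δ,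
      conjGraph n Z ∈ Metric.ball (0 : (Fin n → ℂ) × Space n) δ := by
    intro Z hZ
    rw [mem_ball_zero_iff] at hZ ⊢
    rwa [norm_conjGraph]
  -- Each directional derivative again vanishes on the totally real set, so the vanishing of the
  -- differential can be iterated to every order.
  refine eqOn_zero_of_iterDirDeriv_eq_zero hf fun v k => ?_
  have key : DifferentiableOn ℂ (iterDirDeriv v f k) (Metric.ball 0 δ) ∧
      ∀ Z ∈ Metric.ball (0 : Space n) δ, Z ∈ M → iterDirDeriv v f k (conjGraph n Z) = 0 := by
    induction k with
    | zero => exact ⟨hf, hf0⟩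
    | succ k ih =>
      refine ⟨differentiableOn_fderiv_apply Metric.isOpen_ball ih.1 v, fun Z hZ hZM => ?_⟩
      have hZn : ∀ᶠ Y in 𝓝 Z, Y ∈ Metric.ball (0 : Space n) δ := Metric.isOpen_ball.mem_nhds hZ
      have hn : Metric.ball (0 : (Fin n → ℂ) × Space n) δ ∈ 𝓝 (conjGraph n Z) :=
        Metric.isOpen_ball.mem_nhds (hmem Z hZ)
      have := fderiv_eq_zero_of_totallyReal hM hZM (hQ.differentiableAt hn)
        (hZn.mono h0) (ih.1.differentiableAt hn) (hZn.mono ih.2)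
      simp only [iterDirDeriv, this, zero_apply]
  rw [← map_zero (conjGraph n)]
  exact key.2 0 (Metric.mem_ball_self hδ) h0M

/-! ### Multiindex derivatives of order at most two. -/

theorem foldr_pderivC_zero (α : Fin n → ℕ) (l : List (Fin n)) (h : (l.map α).sum = 0)
    (f : (Fin n → ℂ) → ℂ) : l.foldr (fun i g => (pderivC i)^[α i] g) f = f := by
  induction l with
  | nil => rfl
  | cons a l ih =>
    simp only [List.map_cons, List.sum_cons, Nat.add_eq_zero_iff] at h
    rw [List.foldr_cons, ih h.2, h.1, Function.iterate_zero, id]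

theorem foldr_pderivC_one (α : Fin n → ℕ) (l : List (Fin n)) (h : (l.map α).sum = 1) :
    ∃ i, α i ≠ 0 ∧ ∀ f : (Fin n → ℂ) → ℂ,
      l.foldr (fun i g => (pderivC i)^[α i] g) f = pderivC i f := by
  induction l with
  | nil => simp at h
  | cons a l ih =>
    simp only [List.map_cons, List.sum_cons] at h
    obtain h' | h' : α a = 0 ∨ α a = 1 := by omega
    · obtain ⟨i, hi, hf⟩ := ih (by omega)
      exact ⟨i, hi, fun f => by rw [List.foldr_cons, hf, h', Function.iterate_zero, id]⟩
    · refine ⟨a, by omega, fun f => ?_⟩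
      rw [List.foldr_cons, foldr_pderivC_zero α l (by omega), h', Function.iterate_one]

/-- A list of exponents with sum two has either one entry 2, giving i = k, or two entries 1. Both
indices lie in the support, which is how supp α ⊂ I enters later. -/
theorem foldr_pderivC_two (α : Fin n → ℕ) (l : List (Fin n)) (h : (l.map α).sum = 2) :
    ∃ i k, α i ≠ 0 ∧ α k ≠ 0 ∧ ∀ f : (Fin n → ℂ) → ℂ,
      l.foldr (fun i g => (pderivC i)^[α i] g) f = pderivC i (pderivC k f) := by
  induction l with
  | nil => simp at h
  | cons a l ih =>
    simp only [List.map_cons, List.sum_cons] at h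
    obtain h' | h' | h' : α a = 0 ∨ α a = 1 ∨ α a = 2 := by omega
    · obtain ⟨i, k, hi, hk, hf⟩ := ih (by omega)
      exact ⟨i, k, hi, hk, fun f => by rw [List.foldr_cons, hf, h', Function.iterate_zero, id]⟩
    · obtain ⟨k, hk, hf⟩ := foldr_pderivC_one α l (by omega)
      refine ⟨a, k, by omega, hk, fun f => ?_⟩
      rw [List.foldr_cons, hf, h', Function.iterate_one]
    · refine ⟨a, a, by omega, by omega, fun f => ?_⟩
      rw [List.foldr_cons, foldr_pderivC_zero α l (by omega), h']
      rfl

theorem multiDeriv_single (i : Fin n) (f : (Fin n → ℂ) → ℂ) :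
    multiDeriv (Pi.single i 1) f = pderivC i f := by
  obtain ⟨k, hk, hf⟩ := foldr_pderivC_one (Pi.single i 1) (List.finRange n)
    (by rw [← Fin.sum_univ_def]; simp)
  have : k = i := by
    by_contra h
    exact hk (Pi.single_eq_of_ne h _)
  rw [multiDeriv, hf, this]

theorem exists_multiDeriv_eq_of_sum_eq_two {α : Fin n → ℕ} (h : ∑ i, α i = 2) :
    ∃ i k, α i ≠ 0 ∧ α k ≠ 0 ∧ ∀ f : (Fin n → ℂ) → ℂ,
      multiDeriv α f = pderivC i (pderivC k f) :=
  foldr_pderivC_two α (List.finRange n) (by rw [← Fin.sum_univ_def, h])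

theorem pderivC_eq_fderiv {f : (Fin n → ℂ) → ℂ} {z : Fin n → ℂ} (hf : DifferentiableAt ℂ f z)
    (i : Fin n) : pderivC i f z = fderiv ℂ f z (Pi.single i 1) :=
  hf.lineDeriv_eq_fderiv

theorem pderivC_pderivC_eq_fderiv {f : (Fin n → ℂ) → ℂ} {U : Set (Fin n → ℂ)} (hU : IsOpen U)
    (hf : DifferentiableOn ℂ f U) {z : Fin n → ℂ} (hz : z ∈ U) (i k : Fin n) :
    pderivC i (pderivC k f) z =
      fderiv ℂ (fun z => fderiv ℂ f z (Pi.single k 1)) z (Pi.single i 1) := by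
  have h : pderivC k f =ᶠ[𝓝 z] fun z => fderiv ℂ f z (Pi.single k 1) := by
    filter_upwards [hU.mem_nhds hz] with y hy
    exact pderivC_eq_fderiv (hf.differentiableAt (hU.mem_nhds hy)) k
  rw [pderivC_eq_fderiv, h.fderiv_eq]
  exact ((differentiableOn_fderiv_apply hU hf _).differentiableAt
    (hU.mem_nhds hz)).congr_of_eventuallyEq h

/-! ### Derivatives in z as derivatives of Q on the full space. -/

section Slice

variable {D : Set ((Fin n → ℂ) × Space n)} {Q : (Fin n → ℂ) × Space n → ℂ}

theorem isOpen_slice (hD : IsOpen D) (ξ : Space n) : IsOpen {z : Fin n → ℂ | (z, ξ) ∈ D} :=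
  hD.preimage (by fun_prop : Continuous fun z : Fin n → ℂ => (z, ξ))

theorem hasFDerivAt_slice {W : Type*} [NormedAddCommGroup W] [NormedSpace ℂ W]
    {f : (Fin n → ℂ) × Space n → W} {z : Fin n → ℂ} {ξ : Space n}
    (hf : DifferentiableAt ℂ f (z, ξ)) :
    HasFDerivAt (fun z => f (z, ξ))
      ((fderiv ℂ f (z, ξ)).comp (ContinuousLinearMap.inl ℂ (Fin n → ℂ) (Space n))) z :=
  hf.hasFDerivAt.comp z (hasFDerivAt_prodMk_left z ξ)

theorem fderiv_slice {W : Type*} [NormedAddCommGroup W] [NormedSpace ℂ W]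
    {f : (Fin n → ℂ) × Space n → W} {z : Fin n → ℂ} {ξ : Space n}
    (hf : DifferentiableAt ℂ f (z, ξ)) (v : Fin n → ℂ) :
    fderiv ℂ (fun z => f (z, ξ)) z v = fderiv ℂ f (z, ξ) (v, 0) := by
  rw [(hasFDerivAt_slice hf).fderiv]
  rfl

theorem differentiableOn_slice (hD : IsOpen D) (hQ : DifferentiableOn ℂ Q D) (ξ : Space n) :
    DifferentiableOn ℂ (fun z => Q (z, ξ)) {z | (z, ξ) ∈ D} := fun _ hz =>
  (hasFDerivAt_slice (hQ.differentiableAt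
    (hD.mem_nhds hz))).differentiableAt.differentiableWithinAt

theorem fderiv_fderiv_slice (hD : IsOpen D) (hQ : DifferentiableOn ℂ Q D) {z : Fin n → ℂ}
    {ξ : Space n} (hz : (z, ξ) ∈ D) (v w : Fin n → ℂ) :
    fderiv ℂ (fun z => fderiv ℂ (fun z => Q (z, ξ)) z v) z w =
      fderiv ℂ (fun x => fderiv ℂ Q x (v, 0)) (z, ξ) (w, 0) := by
  rw [← fderiv_slice ((differentiableOn_fderiv_apply hD hQ _).differentiableAt (hD.mem_nhds hz))]
  congr 1
  refine Filter.EventuallyEq.fderiv_eq ?_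
  filter_upwards [(isOpen_slice hD ξ).mem_nhds hz] with y hy
  exact fderiv_slice (hQ.differentiableAt (hD.mem_nhds hy)) v

theorem derivQ_single (hD : IsOpen D) (hQ : DifferentiableOn ℂ Q D) {ζ : Space n}
    (hζ : (0, star ζ) ∈ D) (i : Fin n) :
    derivQ Q (Pi.single i 1) ζ = fderiv ℂ Q (0, star ζ) (Pi.single i 1, 0) := by
  rw [derivQ, multiDeriv_single, pderivC_eq_fderiv, fderiv_slice]
  · exact hQ.differentiableAt (hD.mem_nhds hζ)
  · exact (differentiableOn_slice hD hQ (star ζ)).differentiableAt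
      ((isOpen_slice hD _).mem_nhds hζ)

theorem exists_derivQ_eq_of_sum_eq_two (hD : IsOpen D) (hQ : DifferentiableOn ℂ Q D)
    {α : Fin n → ℕ} (h : ∑ i, α i = 2) :
    ∃ i k, α i ≠ 0 ∧ α k ≠ 0 ∧ ∀ ζ : Space n, (0, star ζ) ∈ D →
      derivQ Q α ζ =
        fderiv ℂ (fun x => fderiv ℂ Q x (Pi.single k 1, 0)) (0, star ζ) (Pi.single i 1, 0) := by
  obtain ⟨i, k, hi, hk, hf⟩ := exists_multiDeriv_eq_of_sum_eq_two h
  refine ⟨i, k, hi, hk, fun ζ hζ => ?_⟩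
  rw [derivQ, hf, pderivC_pderivC_eq_fderiv (isOpen_slice hD (star ζ))
    (differentiableOn_slice hD hQ (star ζ)) hζ, fderiv_fderiv_slice hD hQ hζ]

end Slice

/-! ### Segre varieties and the set S_{0,V_I}. -/

theorem mem_of_tangent {E : Type*} [NormedAddCommGroup E] [NormedSpace ℝ E] {M : Set E}
    {p v : E} (hv : v ∈ tangentVectors M p) : p ∈ M := by
  obtain ⟨γ, h0, -, hM⟩ := hv
  exact h0 ▸ hM.self_of_nhds

theorem zero_mem_tangentVectors {E : Type*} [NormedAddCommGroup E] [NormedSpace ℝ E] {M : Set E}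
    {p : E} (hp : p ∈ M) : 0 ∈ tangentVectors M p :=
  ⟨fun _ => p, rfl, hasDerivAt_const _ _, Eventually.of_forall fun _ => hp⟩

section SegreSub

variable {D : Set ((Fin n → ℂ) × Space n)} {Q : (Fin n → ℂ) × Space n → ℂ} {M : Set (Space n)}

theorem snd_eq_fderiv_of_tangent_segre (hD : IsOpen D) (hQ : DifferentiableOn ℂ Q D)
    {ζ v : Space n} (hv : v ∈ tangentVectors (segre D Q ζ) 0) :
    v.2 = fderiv ℂ Q (0, star ζ) (v.1, 0) := by
  have hmem : (0, star ζ) ∈ D := (mem_of_tangent hv).1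
  have h1 := (hasFDerivAt_slice (z := (0 : Space n).1) (hQ.differentiableAt (hD.mem_nhds hmem))).comp
    (0 : Space n) (ContinuousLinearMap.fst ℂ (Fin n → ℂ) ℂ).hasFDerivAt
  have h2 := (ContinuousLinearMap.snd ℂ (Fin n → ℂ) ℂ).hasFDerivAt (x := (0 : Space n))
  have h3 := hasFDerivAt_apply_eq_zero_of_tangent hv ((h2.sub h1).restrictScalars ℝ) (c := 0)
    (Eventually.of_forall fun Z hZ => sub_eq_zero.mpr hZ.2)
  exact sub_eq_zero.mp h3

theorem IsGivenBy.exists_ball (h : IsGivenBy M D Q) :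
    ∃ δ > 0, Metric.ball 0 δ ⊆ D ∧
      ∀ Z ∈ Metric.ball (0 : Space n) δ, (Z ∈ M ↔ Z.2 = Q (conjGraph n Z)) := by
  obtain ⟨δ₁, hδ₁, h₁⟩ := Metric.eventually_nhds_iff_ball.mp h.mem_iff
  obtain ⟨δ₂, hδ₂, h₂⟩ := Metric.isOpen_iff.mp h.isOpen 0 h.zero_mem
  exact ⟨min δ₁ δ₂, lt_min hδ₁ hδ₂, (Metric.ball_subset_ball (min_le_right _ _)).trans h₂,
    fun Z hZ => h₁ Z (Metric.ball_subset_ball (min_le_left _ _) hZ)⟩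

theorem zero_mem_subspaceV (h0 : 0 ∈ M) (I : Set (Fin n)) : 0 ∈ subspaceV M I :=
  ⟨⟨Submodule.zero_mem _, mem_univ _⟩, zero_mem_tangentVectors h0,
    ⟨0, zero_mem_tangentVectors h0, smul_zero _⟩⟩

/-- The tangency equation v.2 = DQ(v.1, v̄) has a linear and an antilinear part. Since v and iv both
satisfy it, averaging removes the antilinear part and identifies the w-component. -/
theorem single_mem_subspaceV (hM : IsRealAnalyticHypersurface M) (h0 : 0 ∈ M)
    (h : IsGivenBy M D Q) {I : Set (Fin n)} {j : Fin n} (hj : j ∈ I) :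
    ((Pi.single j 1, fderiv ℂ Q 0 (Pi.single j 1, 0)) : Space n) ∈ subspaceV M I := by
  have hQ : DifferentiableAt ℂ Q (conjGraph n 0) := by
    rw [map_zero]
    exact h.differentiableOn.differentiableAt (h.isOpen.mem_nhds h.zero_mem)
  have hev : ∀ᶠ Z in 𝓝 (0 : Space n), Z ∈ M → Z.2 = Q (conjGraph n Z) :=
    h.mem_iff.mono fun Z hZ => hZ.mp
  obtain ⟨R, hR1, c, -, hR⟩ := exists_complex_tangent hM h0 hQ hev
  set v : Space n := (Pi.single j 1, - R (Pi.single j 1, 0)) with hv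
  have hRv : R v = 0 := by
    have : v = (Pi.single j 1, 0) - R (Pi.single j 1, 0) • (0, 1) := by simp [hv]
    rw [this, map_sub, map_smul, hR1]
    simp
  have hT : ∀ a : ℂ, a • v ∈ tangentVectors M 0 := fun a => hR _ (by simp [hRv])
  have e1 := snd_eq_fderiv_of_tangent (hT 1) hQ hev
  have e2 := snd_eq_fderiv_of_tangent (hT Complex.I) hQ hev
  have e3 : conjGraph n (Complex.I • v) =
      Complex.I • (((v.1, 0) : (Fin n → ℂ) × Space n) - (0, star v)) := by simp
  have e4 : conjGraph n ((1 : ℂ) • v) = (v.1, 0) + (0, star v) := by simp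
  rw [e3, map_smul, Prod.smul_snd, smul_right_inj Complex.I_ne_zero, map_sub, map_zero] at e2
  rw [e4, one_smul, map_add, map_zero] at e1
  have e5 : v.2 = fderiv ℂ Q 0 (Pi.single j 1, 0) := by
    have : v.1 = Pi.single j 1 := rfl
    rw [← this]
    linear_combination (e1 + e2) / 2
  have e6 : ((Pi.single j 1, fderiv ℂ Q 0 (Pi.single j 1, 0)) : Space n) = v := by
    rw [← e5]
  rw [e6]
  refine ⟨⟨Submodule.subset_span ⟨j, hj, rfl⟩, mem_univ _⟩, by simpa using hT 1,
    ⟨-Complex.I • v, hT _, ?_⟩⟩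
  simp only [smul_smul]
  simp

/-- The vector (e_j, Q_{z_j}(0, 0)) of V_I must be tangent to S_ζ at 0, and the tangent space there
is the graph of the z-differential of Q at (0, ζ̄). This freezes the slopes indexed by I. -/
theorem of_mem_segreSub (hM : IsRealAnalyticHypersurface M) (h0 : 0 ∈ M)
    (h : IsGivenBy M D Q) {I : Set (Fin n)} {ζ : Space n}
    (hζ : ζ ∈ segreSub D Q (subspaceV M I)) :
    (0, star ζ) ∈ D ∧ Q (0, star ζ) = 0 ∧ ∀ j ∈ I,
      fderiv ℂ Q (0, star ζ) (Pi.single j 1, 0) = fderiv ℂ Q 0 (Pi.single j 1, 0) := by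
  -- The tangent set at a point off S_ζ is empty, so 0 ∈ V_I already forces 0 ∈ S_ζ.
  have hz := mem_of_tangent (hζ.2 (zero_mem_subspaceV h0 I))
  refine ⟨hz.1, hz.2.symm, fun j hj => ?_⟩
  exact (snd_eq_fderiv_of_tangent_segre h.isOpen h.differentiableOn
    (hζ.2 (single_mem_subspaceV hM h0 h hj))).symm

end SegreSub

/-! ### The Segre identity for maps into a hyperquadric, and its derivatives. -/

/-- The first and second order derivatives of a map along the graph of a function. -/
theorem fderiv_along_graph {W V : Type*} [NormedAddCommGroup W] [NormedSpace ℂ W]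
    [CompleteSpace W] [NormedAddCommGroup V] [NormedSpace ℂ V]
    {Φ : Space n → W} {O : Set (Space n)} (hO : IsOpen O)
    (hΦ : DifferentiableOn ℂ Φ O) {q : (Fin n → ℂ) → ℂ} {U : Set (Fin n → ℂ)} (hU : IsOpen U)
    (h0U : 0 ∈ U) (hq : DifferentiableOn ℂ q U) (hq0 : (0, q 0) ∈ O) (θ : W →L[ℂ] V) {κ : V}
    (hκ : ∀ᶠ z in 𝓝 0, θ (Φ (z, q z)) = κ) (v w : Fin n → ℂ) :
    θ (fderiv ℂ Φ (0, q 0) (v, fderiv ℂ q 0 v)) = 0 ∧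
    θ (fderiv ℂ (fderiv ℂ Φ) (0, q 0) (w, fderiv ℂ q 0 w) (v, fderiv ℂ q 0 v) +
      fderiv ℂ (fun z => fderiv ℂ q z v) 0 w • fderiv ℂ Φ (0, q 0) (0, 1)) = 0 := by
  have hgr : ∀ z ∈ U, HasFDerivAt (fun z => (z, q z))
      ((ContinuousLinearMap.id ℂ (Fin n → ℂ)).prod (fderiv ℂ q z)) z := fun z hz =>
    (hasFDerivAt_id z).prodMk (hq.differentiableAt (hU.mem_nhds hz)).hasFDerivAt
  have hUO : ∀ᶠ z in 𝓝 (0 : Fin n → ℂ), z ∈ U ∧ (z, q z) ∈ O :=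
    Filter.Eventually.and (hU.mem_nhds h0U) ((hgr 0 h0U).continuousAt.eventually (hO.mem_nhds hq0))
  have hfirst : ∀ᶠ z in 𝓝 (0 : Fin n → ℂ),
      θ (fderiv ℂ Φ (z, q z) (v, fderiv ℂ q z v)) = 0 := by
    filter_upwards [hκ.eventually_nhds, hUO] with z hz hzU
    have h1 := (hΦ.differentiableAt (hO.mem_nhds hzU.2)).hasFDerivAt
    have h2 := (θ.hasFDerivAt.comp z (h1.comp z (hgr z hzU.1)))
    have h3 := h2.unique ((hasFDerivAt_const κ z).congr_of_eventuallyEq hz)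
    exact DFunLike.congr_fun h3 v
  refine ⟨hfirst.self_of_nhds, ?_⟩
  have h1 := ((differentiableOn_fderiv hO hΦ).differentiableAt (hO.mem_nhds hq0)).hasFDerivAt
  have h2 := h1.comp (0 : Fin n → ℂ) (hgr 0 h0U)
  have h3 := ((differentiableOn_fderiv_apply hU hq v).differentiableAt
    (hU.mem_nhds h0U)).hasFDerivAt
  have h4 := (hasFDerivAt_const v (0 : Fin n → ℂ)).prodMk h3
  have h5 := θ.hasFDerivAt.comp (0 : Fin n → ℂ) (h2.clm_apply h4)
  have h6 := h5.unique ((hasFDerivAt_const (0 : V) 0).congr_of_eventuallyEq hfirst)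
  have h7 := DFunLike.congr_fun h6 w
  have e : ((0, fderiv ℂ (fun z => fderiv ℂ q z v) 0 w) : Space n) =
      fderiv ℂ (fun z => fderiv ℂ q z v) 0 w • (0, 1) := by simp
  rw [← map_smul (fderiv ℂ Φ (0, q 0)), ← e, add_comm]
  simpa using h7

/-- The functional `(x, y) ↦ y - 2i bᵀ A x`. -/
noncomputable def segreForm {N : ℕ} (A : Matrix (Fin N) (Fin N) ℂ) (b : Fin N → ℂ) :
    (Fin N → ℂ) × ℂ →L[ℂ] ℂ :=
  LinearMap.toContinuousLinearMap
    (LinearMap.snd ℂ (Fin N → ℂ) ℂ - (2 * Complex.I) •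
      (dotProductBilin ℂ ℂ b ∘ₗ A.mulVecLin ∘ₗ LinearMap.fst ℂ (Fin N → ℂ) ℂ))

theorem segreForm_apply {N : ℕ} (A : Matrix (Fin N) (Fin N) ℂ) (b : Fin N → ℂ)
    (x : (Fin N → ℂ) × ℂ) : segreForm A b x = x.2 - 2 * Complex.I * (b ⬝ᵥ A.mulVec x.1) := rfl

theorem star_dotProduct_mulVec_comm {N : ℕ} {A : Matrix (Fin N) (Fin N) ℂ} (hA : A.IsHermitian)
    (x y : Fin N → ℂ) : star x ⬝ᵥ A.mulVec y = star (star y ⬝ᵥ A.mulVec x) := by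
  rw [Matrix.star_dotProduct, Matrix.star_mulVec, hA.eq, ← Matrix.dotProduct_mulVec]

theorem hasDerivAt_hermitian {N : ℕ} (A : Matrix (Fin N) (Fin N) ℂ) {x : ℝ → Fin N → ℂ}
    {x' : Fin N → ℂ} {t : ℝ} (hx : HasDerivAt x x' t) :
    HasDerivAt (fun t => star (x t) ⬝ᵥ A.mulVec (x t))
      (star x' ⬝ᵥ A.mulVec (x t) + star (x t) ⬝ᵥ A.mulVec x') t := by
  simp only [dotProduct, Matrix.mulVec, ← Finset.sum_add_distrib]
  have hx' := hasDerivAt_pi.mp hx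
  exact HasDerivAt.fun_sum fun i _ => (hx' i).star.mul
    (HasDerivAt.fun_sum fun j _ => (hx' j).const_mul (A i j))

/-- The imaginary part of the form at a point of the hyperquadric vanishes on tangent vectors. -/
theorem im_segreForm_eq_zero_of_tangent {N : ℕ} {F : Type*} [NormedAddCommGroup F]
    [NormedSpace ℂ F] {A : Matrix (Fin N) (Fin N) ℂ} (hA : A.IsHermitian)
    (L : F →L[ℂ] (Fin N → ℂ) × ℂ) {p u : F}
    (hu : u ∈ tangentVectors
      {x | (((L x).2.im : ℝ) : ℂ) = star (L x).1 ⬝ᵥ A.mulVec (L x).1} p) :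
    (segreForm A (star (L p).1) (L u)).im = 0 := by
  obtain ⟨γ, h0, hγ, hM⟩ := hu
  have hL : HasDerivAt (fun t => L (γ t)) (L u) 0 :=
    (L.restrictScalars ℝ).hasFDerivAt.comp_hasDerivAt 0 hγ
  have h1 : HasDerivAt (fun t => (L (γ t)).1) (L u).1 0 :=
    (ContinuousLinearMap.fst ℝ (Fin N → ℂ) ℂ).hasFDerivAt.comp_hasDerivAt 0 hL
  have h2 : HasDerivAt (fun t => (((L (γ t)).2.im : ℝ) : ℂ)) (((L u).2.im : ℝ) : ℂ) 0 :=
    (Complex.ofRealCLM.comp (Complex.imCLM.comp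
      (ContinuousLinearMap.snd ℝ (Fin N → ℂ) ℂ))).hasFDerivAt.comp_hasDerivAt 0 hL
  have h3 := h2.unique ((hasDerivAt_hermitian A h1).congr_of_eventuallyEq hM)
  rw [h0, star_dotProduct_mulVec_comm hA (L u).1] at h3
  have h4 := congrArg Complex.re h3
  simp only [Complex.ofReal_re, Complex.add_re, Complex.star_def, Complex.conj_re] at h4
  rw [segreForm_apply]
  simp [h4]
  ring

/-- The complexification of the inclusion of `M` into a hyperquadric. -/
theorem exists_segre_identity {N : ℕ} {M : Set (Space n)} (hM : IsRealAnalyticHypersurface M)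
    (h0 : 0 ∈ M) {D : Set ((Fin n → ℂ) × Space n)} {Q : (Fin n → ℂ) × Space n → ℂ}
    (h : IsGivenBy M D Q) {O : Set (Space n)} (hO : IsOpen O) (hMO : M ⊆ O)
    {Φ : Space n → (Fin N → ℂ) × ℂ} (hΦ : DifferentiableOn ℂ Φ O)
    {A : Matrix (Fin N) (Fin N) ℂ}
    (hmap : ∀ Z ∈ M, (((Φ Z).2.im : ℝ) : ℂ) = star (Φ Z).1 ⬝ᵥ A.mulVec (Φ Z).1) :
    ∃ δ > 0, ∀ x ∈ Metric.ball (0 : (Fin n → ℂ) × Space n) δ,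
      segreForm A (star (Φ (star x.2)).1) (Φ (x.1, Q x)) = star (Φ (star x.2)).2 := by
  obtain ⟨δ₁, hδ₁, hsub, hiff⟩ := h.exists_ball
  have hQ := h.differentiableOn
  have hQ0 : Q 0 = 0 := by
    have := (hiff 0 (Metric.mem_ball_self hδ₁)).mp h0
    rw [map_zero] at this
    exact this.symm
  have hnear : ∀ᶠ x in 𝓝 (0 : (Fin n → ℂ) × Space n), (x.1, Q x) ∈ O ∧ star x.2 ∈ O := by
    have hc := (hQ.differentiableAt (h.isOpen.mem_nhds h.zero_mem)).continuousAt
    have h1 : ContinuousAt (fun x : (Fin n → ℂ) × Space n => ((x.1, Q x) : Space n)) 0 :=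
      continuousAt_fst.prodMk hc
    have h2 : ContinuousAt (fun x : (Fin n → ℂ) × Space n => star x.2) 0 := by fun_prop
    refine (h1.eventually (hO.mem_nhds ?_)).and (h2.eventually (hO.mem_nhds ?_))
    · simp only [hQ0]; exact hMO h0
    · simp only [Prod.snd_zero, star_zero]; exact hMO h0
  obtain ⟨δ₂, hδ₂, hnear⟩ := Metric.eventually_nhds_iff_ball.mp hnear
  set δ := min δ₁ δ₂ with hδ
  have hb1 : Metric.ball (0 : (Fin n → ℂ) × Space n) δ ⊆ Metric.ball 0 δ₁ :=
    Metric.ball_subset_ball (min_le_left _ _)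
  have hb2 : Metric.ball (0 : (Fin n → ℂ) × Space n) δ ⊆ Metric.ball 0 δ₂ :=
    Metric.ball_subset_ball (min_le_right _ _)
  have hb3 : Metric.ball (0 : Space n) δ ⊆ Metric.ball 0 δ₁ :=
    Metric.ball_subset_ball (min_le_left _ _)
  refine ⟨δ, lt_min hδ₁ hδ₂, fun x hx => sub_eq_zero.mp ?_⟩
  have hQδ : DifferentiableOn ℂ Q (Metric.ball 0 δ) := hQ.mono (hb1.trans hsub)
  refine eqOn_zero_of_totallyReal hM h0 (lt_min hδ₁ hδ₂) hQδ
    (fun Z hZ => (hiff Z (hb3 hZ)).mp) (f := fun x =>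
      segreForm A (star (Φ (star x.2)).1) (Φ (x.1, Q x)) - star (Φ (star x.2)).2) ?_ ?_ x hx
  · intro y hy
    obtain ⟨hy1, hy2⟩ := hnear y (hb2 hy)
    have d1 : DifferentiableAt ℂ (fun x : (Fin n → ℂ) × Space n => Φ (x.1, Q x)) y :=
      (hΦ.differentiableAt (hO.mem_nhds hy1)).comp y
        (differentiableAt_fst.prodMk (hQδ.differentiableAt (Metric.isOpen_ball.mem_nhds hy)))
    have d2 : DifferentiableAt ℂ (fun x : (Fin n → ℂ) × Space n => star (Φ (star x.2))) y := by
      -- Conjugating both argument and value keeps a map holomorphic.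
      have := (hΦ.differentiableAt (hO.mem_nhds hy2)).star_star
      rw [star_star] at this
      exact this.comp y differentiableAt_snd
    have d3 : DifferentiableAt ℂ (fun x : (Fin n → ℂ) × Space n => star (Φ (star x.2)).1) y :=
      d2.fst
    have d4 : DifferentiableAt ℂ (fun x : (Fin n → ℂ) × Space n => star (Φ (star x.2)).2) y :=
      d2.snd
    refine DifferentiableAt.differentiableWithinAt (DifferentiableAt.sub ?_ d4)
    simp only [segreForm_apply, dotProduct, Matrix.mulVec]
    refine d1.snd.sub (DifferentiableAt.const_mul (DifferentiableAt.fun_sum fun i _ => ?_) _)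
    exact (differentiableAt_pi.mp d3 i).mul (DifferentiableAt.fun_sum fun j _ =>
      (differentiableAt_pi.mp d1.fst j).const_mul _)
  · intro Z hZ hZM
    have e1 := (hiff Z (hb3 hZ)).mp hZM
    have e2 : (((conjGraph n Z).1, Q (conjGraph n Z)) : Space n) = Z := by
      rw [← e1]; rfl
    have e3 : star (conjGraph n Z).2 = Z := star_star Z
    rw [e2, e3, segreForm_apply, ← hmap Z hZM]
    -- On M the form takes the value g - 2i Im g, which is the conjugate of g.
    apply Complex.ext
    · simp
    · simp; ring

/-- The derivatives along the Segre variety of `ζ` of the Segre identity. -/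
theorem segreForm_fderiv_eq_zero {N : ℕ} {D : Set ((Fin n → ℂ) × Space n)}
    {Q : (Fin n → ℂ) × Space n → ℂ} (hD : IsOpen D) (hQ : DifferentiableOn ℂ Q D)
    {O : Set (Space n)} (hO : IsOpen O) (h0O : 0 ∈ O)
    {Φ : Space n → (Fin N → ℂ) × ℂ} (hΦ : DifferentiableOn ℂ Φ O)
    {A : Matrix (Fin N) (Fin N) ℂ} {δ : ℝ}
    (hid : ∀ x ∈ Metric.ball (0 : (Fin n → ℂ) × Space n) δ,
      segreForm A (star (Φ (star x.2)).1) (Φ (x.1, Q x)) = star (Φ (star x.2)).2)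
    {ζ : Space n} (hζδ : ‖ζ‖ < δ) (hζD : (0, star ζ) ∈ D) (hζ0 : Q (0, star ζ) = 0)
    (v w : Fin n → ℂ) :
    segreForm A (star (Φ ζ).1) (fderiv ℂ Φ 0 (v, fderiv ℂ Q (0, star ζ) (v, 0))) = 0 ∧
    segreForm A (star (Φ ζ).1)
      (fderiv ℂ (fderiv ℂ Φ) 0 (w, fderiv ℂ Q (0, star ζ) (w, 0))
          (v, fderiv ℂ Q (0, star ζ) (v, 0)) +
        fderiv ℂ (fun x => fderiv ℂ Q x (v, 0)) (0, star ζ) (w, 0) •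
          fderiv ℂ Φ 0 (0, 1)) = 0 := by
  have hQd : DifferentiableAt ℂ Q (0, star ζ) := hQ.differentiableAt (hD.mem_nhds hζD)
  have hκ : ∀ᶠ z in 𝓝 (0 : Fin n → ℂ),
      segreForm A (star (Φ ζ).1) (Φ (z, Q (z, star ζ))) = star (Φ ζ).2 := by
    have hδ : 0 < δ := (norm_nonneg ζ).trans_lt hζδ
    filter_upwards [Metric.ball_mem_nhds (0 : Fin n → ℂ) hδ] with z hz
    have := hid (z, star ζ) (by
      rw [mem_ball_zero_iff] at hz ⊢
      rw [Prod.norm_def]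
      exact max_lt hz (by simpa using hζδ))
    simpa using this
  have key := fderiv_along_graph hO hΦ (isOpen_slice hD (star ζ)) hζD
    (differentiableOn_slice hD hQ (star ζ)) (by rw [hζ0]; exact h0O)
    (segreForm A (star (Φ ζ).1)) hκ v w
  rw [hζ0, fderiv_slice hQd, fderiv_slice hQd, fderiv_fderiv_slice hD hQ hζD] at key
  exact key

/-! ### The linear relation and its consequence near 0. -/

/-- The kernel of θ has dimension n + m and contains n + m + 1 listed vectors, so they are
dependent. If all coefficients of the β j vanished, independence of p would make the dependence
trivial. -/
theorem exists_relation {W : Type*} [AddCommGroup W] [Module ℂ W] [FiniteDimensional ℂ W]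
    {n m : ℕ} (hW : Module.finrank ℂ W = n + m + 1) {p : Fin n → W}
    (hp : LinearIndependent ℂ p) {θ : W →ₗ[ℂ] ℂ} (hθ : θ ≠ 0) (hθp : ∀ i, θ (p i) = 0)
    {β : Fin (m + 1) → W} (hθβ : ∀ j, θ (β j) = 0) :
    ∃ (lam : Fin (m + 1) → ℂ) (μ : Fin n → ℂ), lam ≠ 0 ∧
      ∑ j, lam j • β j = ∑ i, μ i • p i := by
  let f : Fin n ⊕ Fin (m + 1) → LinearMap.ker θ :=
    Sum.elim (fun i => ⟨p i, hθp i⟩) (fun j => ⟨β j, hθβ j⟩)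
  have hker : Module.finrank ℂ (LinearMap.ker θ) = n + m := by
    have := Module.Dual.finrank_ker_add_one_of_ne_zero (f := θ) hθ
    omega
  have hnot : ¬ LinearIndependent ℂ f := by
    intro h
    have := h.fintype_card_le_finrank
    simp only [Fintype.card_sum, Fintype.card_fin, hker] at this
    omega
  obtain ⟨g, hg, k, hk⟩ := Fintype.not_linearIndependent_iff.mp hnot
  have hg' : ∑ i, g (Sum.inl i) • p i + ∑ j, g (Sum.inr j) • β j = 0 := by
    have := congrArg (Subtype.val) hg
    simpa [f, Fintype.sum_sum_type] using this
  refine ⟨fun j => g (Sum.inr j), fun i => - g (Sum.inl i), fun hl => ?_, ?_⟩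
  · have hl' : ∀ j, g (Sum.inr j) = 0 := fun j => congrFun hl j
    simp only [hl', zero_smul, Finset.sum_const_zero, add_zero] at hg'
    have := Fintype.linearIndependent_iff.mp hp _ hg'
    rcases k with i | j
    · exact hk (this i)
    · exact hk (hl' j)
  · simp only [neg_smul, Finset.sum_neg_distrib]
    exact eq_neg_of_add_eq_zero_right hg'

/-- The relation between the derivatives of `Q`, for a map into a hyperquadric. -/
theorem exists_relation_near_zero {n m : ℕ} {M : Set (Space n)}
    (hM : IsRealAnalyticHypersurface M) (h0 : 0 ∈ M) {D : Set ((Fin n → ℂ) × Space n)}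
    {Q : (Fin n → ℂ) × Space n → ℂ} (h : IsGivenBy M D Q) {O : Set (Space n)} (hO : IsOpen O)
    (hMO : M ⊆ O) {Φ : Space n → (Fin (n + m) → ℂ) × ℂ} (hΦ : DifferentiableOn ℂ Φ O)
    {A : Matrix (Fin (n + m)) (Fin (n + m)) ℂ}
    (hmap : ∀ Z ∈ M, (((Φ Z).2.im : ℝ) : ℂ) = star (Φ Z).1 ⬝ᵥ A.mulVec (Φ Z).1)
    (hinj : Function.Injective (fderiv ℂ Φ 0))
    (htrans : ∃ v, segreForm A (star (Φ 0).1) (fderiv ℂ Φ 0 v) ≠ 0)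
    (I : Set (Fin n)) (a b : Fin (m + 1) → Fin n) (ha : ∀ j, a j ∈ I) (hb : ∀ j, b j ∈ I) :
    ∃ (lam : Fin (m + 1) → ℂ) (μ : Fin n → ℂ) (c : ℂ), lam ≠ 0 ∧
      ∀ᶠ ζ in 𝓝 (0 : Space n), ζ ∈ segreSub D Q (subspaceV M I) →
        ∑ j, lam j * fderiv ℂ (fun x => fderiv ℂ Q x (Pi.single (b j) 1, 0)) (0, star ζ)
          (Pi.single (a j) 1, 0) =
        c + ∑ i, μ i * fderiv ℂ Q (0, star ζ) (Pi.single i 1, 0) := by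
  obtain ⟨δ, hδ, hid⟩ := exists_segre_identity hM h0 h hO hMO hΦ hmap
  have key := fun {ζ : Space n} => segreForm_fderiv_eq_zero (ζ := ζ) h.isOpen h.differentiableOn hO
    (hMO h0) hΦ hid
  have hQ0 : Q (0, star (0 : Space n)) = 0 := (h.mem_iff.self_of_nhds.mp h0).symm
  have h0D : ((0, star (0 : Space n)) : (Fin n → ℂ) × Space n) ∈ D := by
    rw [star_zero]; exact h.zero_mem
  have key0 := key (ζ := 0) (by simpa using hδ) h0D hQ0
  have hz : ((0, star (0 : Space n)) : (Fin n → ℂ) × Space n) = 0 := by rw [star_zero]; rfl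
  rw [hz] at key0
  set e : Fin n → Fin n → ℂ := fun i => Pi.single i 1 with he
  set q : Fin n → ℂ := fun i => fderiv ℂ Q 0 (e i, 0) with hq
  set T := fderiv ℂ Φ 0 with hT
  set p : Fin n → (Fin (n + m) → ℂ) × ℂ := fun i => T (e i, q i) with hp
  set θ := fun ζ : Space n => segreForm A (star (Φ ζ).1) with hθ
  -- The vectors (e_i, q_i) and (0, 1) span. As θ_0 ∘ T kills the former and is not zero, it cannot
  -- kill (0, 1).
  have hdecomp : ∀ v : Space n, v = ∑ i, v.1 i • ((e i, q i) : Space n) +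
      (v.2 - ∑ i, v.1 i * q i) • ((0, 1) : Space n) := by
    intro v
    refine Prod.ext ?_ ?_
    · simp only [Prod.fst_add, Prod.fst_sum, Prod.smul_fst, smul_zero, add_zero, he]
      exact pi_eq_sum_univ' v.1
    · simp [Prod.snd_sum]
  have hθp : ∀ i, θ 0 (p i) = 0 := fun i => (key0 (e i) 0).1
  have hw : θ 0 (T (0, 1)) ≠ 0 := by
    obtain ⟨v, hv⟩ := htrans
    intro hc
    apply hv
    rw [hdecomp v, map_add, map_add, map_sum, map_sum, map_smul, map_smul]
    have : ∀ i, θ 0 (T (v.1 i • (e i, q i))) = 0 := fun i => by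
      rw [map_smul, map_smul, hθp, smul_zero]
    change ∑ i, θ 0 (T (v.1 i • (e i, q i))) + _ • θ 0 (T (0, 1)) = 0
    rw [Finset.sum_eq_zero fun i _ => this i, hc, smul_zero, add_zero]
  have hli : LinearIndependent ℂ p := by
    rw [Fintype.linearIndependent_iff]
    intro g hg i
    have h1 : T (∑ i, g i • ((e i, q i) : Space n)) = T 0 := by
      rw [map_sum, map_zero, ← hg]
      exact Finset.sum_congr rfl fun i _ => map_smul T _ _
    have h2 := congrArg Prod.fst (hinj h1)
    have h3 : (∑ i, g i • ((e i, q i) : Space n)).1 = g := by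
      rw [Prod.fst_sum]
      exact (pi_eq_sum_univ' g).symm
    rw [h3] at h2
    exact congrFun h2 i
  set B : Fin (m + 1) → (Fin (n + m) → ℂ) × ℂ := fun j =>
    fderiv ℂ (fderiv ℂ Φ) 0 (e (a j), q (a j)) (e (b j), q (b j)) with hB
  set s : Fin (m + 1) → ℂ := fun j =>
    fderiv ℂ (fun x => fderiv ℂ Q x (e (b j), 0)) 0 (e (a j), 0) with hs
  have hθβ : ∀ j, θ 0 (B j + s j • T (0, 1)) = 0 := fun j => (key0 (e (b j)) (e (a j))).2
  have hne : (θ 0 : (Fin (n + m) → ℂ) × ℂ →ₗ[ℂ] ℂ) ≠ 0 := fun hc =>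
    hw (LinearMap.congr_fun hc (T (0, 1)))
  obtain ⟨lam, μ, hlam, hrel⟩ := exists_relation (by simp) hli hne hθp hθβ
  -- The constant collects the values at ζ = 0 that arise when θ_ζ is applied to the relation.
  refine ⟨lam, μ, ∑ j, lam j * s j - ∑ i, μ i * q i, hlam, ?_⟩
  have hcont : ContinuousAt (fun ζ => θ ζ (T (0, 1))) 0 := by
    have d := (hΦ.differentiableAt (hO.mem_nhds (hMO h0))).continuousAt
    simp only [hθ, segreForm_apply, dotProduct]
    fun_prop
  filter_upwards [hcont.eventually_ne hw, Metric.ball_mem_nhds (0 : Space n) hδ] with ζ hζw hζδ hζ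
  obtain ⟨hζD, hζ0, hζI⟩ := of_mem_segreSub hM h0 h hζ
  have keyζ := key (by simpa using hζδ) hζD hζ0
  have hζp : ∀ i, θ ζ (p i) = (q i - fderiv ℂ Q (0, star ζ) (e i, 0)) * θ ζ (T (0, 1)) := by
    intro i
    have h1 := (keyζ (e i) 0).1
    have h2 : ((e i, q i) : Space n) = (e i, fderiv ℂ Q (0, star ζ) (e i, 0)) +
        (q i - fderiv ℂ Q (0, star ζ) (e i, 0)) • (0, 1) := by simp
    simp only [hp]
    rw [h2, map_add, map_add, map_smul, map_smul, smul_eq_mul]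
    exact (congrArg (· + _) h1).trans (zero_add _)
  have hζβ : ∀ j, θ ζ (B j + s j • T (0, 1)) =
      (s j - fderiv ℂ (fun x => fderiv ℂ Q x (e (b j), 0)) (0, star ζ) (e (a j), 0)) *
        θ ζ (T (0, 1)) := by
    intro j
    have h1 := (keyζ (e (b j)) (e (a j))).2
    -- Here membership in S_{0,V_I} replaces the slopes at ζ by those at 0, so that the
    -- second-derivative term becomes B j.
    rw [hζI _ (ha j), hζI _ (hb j), map_add, map_smul, smul_eq_mul] at h1
    rw [map_add, map_smul, smul_eq_mul, sub_mul]
    linear_combination h1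
  have h1 := congrArg (θ ζ) hrel
  simp only [map_sum, map_smul, hζp, hζβ, smul_eq_mul, ← mul_assoc, ← Finset.sum_mul] at h1
  have h2 := mul_right_cancel₀ hζw h1
  simp only [mul_sub, Finset.sum_sub_distrib] at h2
  linear_combination -h2

/-! ### Propagation along connected complex submanifolds. -/

/-- The identity theorem on a connected complex submanifold. -/
theorem IsComplexSubmanifold.eqOn_zero {E : Type*} [NormedAddCommGroup E] [NormedSpace ℂ E]
    {N U : Set E} (hN : IsComplexSubmanifold N) (hNc : IsConnected N) (hU : IsOpen U)
    (hNU : N ⊆ U) {G : E → ℂ} (hG : DifferentiableOn ℂ G U) {p : E} (hp : p ∈ N)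
    (h0 : ∀ᶠ x in 𝓝[N] p, G x = 0) : ∀ x ∈ N, G x = 0 := by
  have : PreconnectedSpace N := isPreconnected_iff_preconnectedSpace.mp hNc.isPreconnected
  let S : Set N := {x | ∀ᶠ y : N in 𝓝 x, G y = 0}
  have hS : ∀ x : N, x ∈ S ↔ ∀ᶠ y in 𝓝[N] (x : E), G y = 0 := fun x => by
    rw [nhdsWithin_eq_map_subtype_coe x.2, eventually_map]
    rfl
  have hopen : IsOpen S := isOpen_iff_mem_nhds.mpr fun x hx => eventually_eventually_nhds.mpr hx
  have hclosed : IsClosed S := by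
    refine isClosed_of_closure_subset fun x hx => ?_
    obtain ⟨e, K, hxe, -, he', hK⟩ := hN x x.2
    have hsymm : ContinuousAt e.symm (e x) := e.continuousAt_symm (e.map_source hxe)
    obtain ⟨r, hr, hB⟩ := Metric.eventually_nhds_iff_ball.mp
      (Filter.Eventually.and (e.open_target.mem_nhds (e.map_source hxe))
        (hsymm.eventually (hU.mem_nhds (by rw [e.left_inv hxe]; exact hNU x.2))))
    have hV : ∀ᶠ z in 𝓝 (x : E), z ∈ e.source ∧ e z ∈ Metric.ball (e x) r :=
      Filter.Eventually.and (e.open_source.mem_nhds hxe)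
        ((e.continuousAt hxe).eventually (Metric.ball_mem_nhds _ hr))
    -- In a chart at the limit point x, the submanifold is a linear subspace meeting a ball in a
    -- convex set. The function vanishes near the image of y, hence on the whole slice, which
    -- contains the image of x.
    obtain ⟨y, ⟨hye, hyB⟩, hyS⟩ := mem_closure_iff_nhds.mp hx _ (continuousAt_subtype_val.eventually hV)
    have hsub : Continuous (Subtype.val : K → E) := continuous_subtype_val
    have hd : DifferentiableOn ℂ (fun k : K => G (e.symm k))
        (Subtype.val ⁻¹' Metric.ball (e x) r) := by
      intro k hk
      obtain ⟨hkt, hkU⟩ := hB _ hk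
      have h1 : DifferentiableAt ℂ e.symm (k : E) :=
        he'.differentiableAt (e.open_target.mem_nhds hkt)
      have h2 : DifferentiableAt ℂ G (e.symm k) := hG.differentiableAt (hU.mem_nhds hkU)
      exact ((h2.comp (k : E) h1).comp k K.subtypeL.differentiableAt).differentiableWithinAt
    have hconv : Convex ℝ (Subtype.val ⁻¹' Metric.ball (e x) r : Set K) :=
      (convex_ball (e x) r).linear_preimage (K.subtype.restrictScalars ℝ)
    have hyK : e y ∈ K := (hK y hye).mp y.2
    have hev : ∀ᶠ k : K in 𝓝 ⟨e y, hyK⟩, G (e.symm k) = 0 := by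
      have hyt := e.map_source hye
      have h1 : Tendsto (fun k : K => e.symm k) (𝓝 ⟨e y, hyK⟩) (𝓝 (y : E)) := by
        have := (e.continuousAt_symm hyt).tendsto.comp (hsub.tendsto ⟨e y, hyK⟩)
        rwa [e.left_inv hye] at this
      have h2 : ∀ᶠ k : K in 𝓝 ⟨e y, hyK⟩, (k : E) ∈ e.target :=
        hsub.continuousAt.eventually (e.open_target.mem_nhds hyt)
      filter_upwards [h1.eventually (eventually_nhdsWithin_iff.mp ((hS y).mp hyS)), h2]
        with k hk hkt
      refine hk ((hK _ (e.map_target hkt)).mpr ?_)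
      rw [e.right_inv hkt]
      exact k.2
    have hzero := eqOn_zero_of_convex (Metric.isOpen_ball.preimage hsub) hconv hd
      (x₀ := ⟨e y, hyK⟩) hyB hev
    rw [hS, eventually_nhdsWithin_iff]
    filter_upwards [hV] with z hz hzN
    have := hzero ⟨e z, (hK z hz.1).mp hzN⟩ hz.2
    simpa [e.left_inv hz.1] using this
  have huniv : S = univ := IsClopen.eq_univ ⟨hclosed, hopen⟩ ⟨⟨p, hp⟩, (hS _).mpr h0⟩
  intro x hx
  have : (⟨x, hx⟩ : N) ∈ S := huniv ▸ mem_univ _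
  exact this.self_of_nhds

/-! ### From the transversal embedding to the theorem. -/

/-- The relation between the derivatives of `Q` near `0`, in terms of a transversal embedding. -/
theorem exists_relation_of_embeddable {n m : ℕ} {M : Set (Space n)}
    (hM : IsRealAnalyticHypersurface M) (h0 : 0 ∈ M) {D : Set ((Fin n → ℂ) × Space n)}
    {Q : (Fin n → ℂ) × Space n → ℂ} (h : IsGivenBy M D Q)
    {M' : Set (Fin (n + m + 1) → ℂ)} (hM' : IsRealHyperquadric M')
    (hemb : TransversallyEmbeddable M M')
    (I : Set (Fin n)) (a b : Fin (m + 1) → Fin n) (ha : ∀ j, a j ∈ I) (hb : ∀ j, b j ∈ I) :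
    ∃ (lam : Fin (m + 1) → ℂ) (μ : Fin n → ℂ) (c : ℂ), lam ≠ 0 ∧
      ∀ᶠ ζ in 𝓝 (0 : Space n), ζ ∈ segreSub D Q (subspaceV M I) →
        ∑ j, lam j * fderiv ℂ (fun x => fderiv ℂ Q x (Pi.single (b j) 1, 0)) (0, star ζ)
          (Pi.single (a j) 1, 0) =
        c + ∑ i, μ i * fderiv ℂ Q (0, star ζ) (Pi.single i 1, 0) := by
  obtain ⟨L, A, hA, rfl⟩ := hM'
  obtain ⟨O, H, hO, hMO, hH, hmaps, htr⟩ := hemb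
  let Lc := L.toContinuousLinearEquiv
  have hf : fderiv ℂ (fun Z => Lc (H Z)) 0 = (Lc : (Fin (n + m + 1) → ℂ) →L[ℂ] _).comp (fderiv ℂ H 0) :=
    Lc.comp_fderiv
  refine exists_relation_near_zero hM h0 h hO hMO (Φ := fun Z => Lc (H Z)) (A := A)
    (Lc.differentiable.comp_differentiableOn hH.differentiableOn) (fun Z hZ => hmaps hZ) ?_ ?_
    I a b ha hb
  · rw [hf]
    exact Lc.injective.comp (hH.immersion 0 (hMO h0))
  · by_contra! hc
    -- The form sends (0, i) to i, but it is real on tangent vectors of the hyperquadric. If it also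
    -- vanished on the image of the differential, transversality would make the imaginary part of i
    -- zero.
    obtain ⟨_, ⟨v, rfl⟩, u, hu, hvu⟩ := Set.mem_add.mp
      ((htr 0 h0).symm ▸ mem_univ (Lc.symm (0, Complex.I)) :
        Lc.symm (0, Complex.I) ∈ range (fderiv ℂ H 0) + _)
    have h1 := hc v
    have h2 := im_segreForm_eq_zero_of_tangent hA (Lc : (Fin (n + m + 1) → ℂ) →L[ℂ] _) hu
    have h3 : segreForm A (star (Lc (H 0)).1) (0, Complex.I) = Complex.I := by
      simp [segreForm_apply]
    rw [← Lc.apply_symm_apply (0, Complex.I), ← hvu, map_add, map_add] at h3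
    rw [hf] at h1
    have h4 := congrArg Complex.im h3
    rw [Complex.add_im] at h4
    have h5 : (segreForm A (star (Lc (H 0)).1) (Lc (fderiv ℂ H 0 v))).im = 0 := by
      rw [show segreForm A (star (Lc (H 0)).1) (Lc (fderiv ℂ H 0 v)) = 0 from h1]; rfl
    have h6 : (segreForm A (star (Lc (H 0)).1) (Lc u)).im = 0 := h2
    rw [h5, h6] at h4
    simp at h4

/-- A polynomial of degree at most one with given coefficients. -/
theorem exists_affine_polynomial {n : ℕ} (c : ℂ) (μ : Fin n → ℂ) :
    ∃ R : MvPolynomial (Fin n) ℂ, R.totalDegree ≤ 1 ∧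
      ∀ x : Fin n → ℂ, MvPolynomial.eval x R = c + ∑ i, μ i * x i := by
  refine ⟨MvPolynomial.C c + ∑ i, MvPolynomial.C (μ i) * MvPolynomial.X i, ?_, fun x => by simp⟩
  refine (MvPolynomial.totalDegree_add _ _).trans (max_le (by simp) ?_)
  refine MvPolynomial.totalDegree_finsetSum_le fun i _ => ?_
  refine (MvPolynomial.totalDegree_mul _ _).trans ?_
  simp

end SegreRelation

theorem corollary7p2 (n m : ℕ)
    (M : Set (SegreRelation.Space n))
    (hM : SegreRelation.IsRealAnalyticHypersurface M) (h0 : (0 : SegreRelation.Space n) ∈ M)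
    (D : Set ((Fin n → ℂ) × SegreRelation.Space n))
    (Q : (Fin n → ℂ) × SegreRelation.Space n → ℂ)
    (hQ : SegreRelation.IsGivenBy M D Q)
    (hemb : ∃ M' : Set (Fin (n + m + 1) → ℂ), SegreRelation.IsRealHyperquadric M' ∧
      SegreRelation.TransversallyEmbeddable M M')
    (I : Set (Fin n)) (hI : I ⊂ Set.univ)
    (α : Fin (m + 1) → Fin n → ℕ) (hα : ∀ j, ∑ i, α j i = 2)
    (hsupp : ∀ j, Function.support (α j) ⊆ I) :
    ∃ (lam : Fin (m + 1) → ℂ) (R : MvPolynomial (Fin n) ℂ), lam ≠ 0 ∧ R.totalDegree ≤ 1 ∧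
      (∀ᶠ ζ in 𝓝[SegreRelation.segreSub D Q (SegreRelation.subspaceV M I)] 0,
        ∑ j, lam j * SegreRelation.derivQ Q (α j) ζ =
          MvPolynomial.eval (fun i => SegreRelation.derivQ Q (Pi.single i 1) ζ) R) ∧
      (∀ N ⊆ SegreRelation.segreSub D Q (SegreRelation.subspaceV M I), 0 ∈ N →
        IsConnected N → SegreRelation.IsComplexSubmanifold N → ∀ ζ ∈ N,
          ∑ j, lam j * SegreRelation.derivQ Q (α j) ζ =
            MvPolynomial.eval (fun i => SegreRelation.derivQ Q (Pi.single i 1) ζ) R) := by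
  open SegreRelation in
  have hD := hQ.isOpen
  have hQd := hQ.differentiableOn
  choose a b ha hb hab using fun j => exists_derivQ_eq_of_sum_eq_two hD hQd (hα j)
  obtain ⟨M', hM', hemb⟩ := hemb
  obtain ⟨lam, μ, c, hlam, hrel⟩ := exists_relation_of_embeddable hM h0 hQ hM' hemb I a b
    (fun j => hsupp j (ha j)) (fun j => hsupp j (hb j))
  obtain ⟨R, hR, hReval⟩ := exists_affine_polynomial c μ
  set S := segreSub D Q (subspaceV M I)
  set g : Space n → ℂ := fun ξ =>
    ∑ j, lam j * fderiv ℂ (fun x => fderiv ℂ Q x (Pi.single (b j) 1, 0)) (0, ξ)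
      (Pi.single (a j) 1, 0) - (c + ∑ i, μ i * fderiv ℂ Q (0, ξ) (Pi.single i 1, 0)) with hg
  have hmemD : ∀ ζ ∈ S, (0, star ζ) ∈ D := fun ζ hζ => (of_mem_segreSub hM h0 hQ hζ).1
  have hiff : ∀ ζ ∈ S, (∑ j, lam j * derivQ Q (α j) ζ =
      MvPolynomial.eval (fun i => derivQ Q (Pi.single i 1) ζ) R ↔ g (star ζ) = 0) := by
    intro ζ hζ
    simp only [hReval, derivQ_single hD hQd (hmemD ζ hζ), hab _ ζ (hmemD ζ hζ), hg, sub_eq_zero]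
  refine ⟨lam, R, hlam, hR, ?_, fun N hNS h0N hNc hN ζ hζ => ?_⟩
  · rw [eventually_nhdsWithin_iff]
    filter_upwards [hrel] with ζ hζ hζS
    exact (hiff ζ hζS).mpr (sub_eq_zero.mpr (hζ hζS))
  · rw [hiff ζ (hNS hζ)]
    have hU : IsOpen {ζ : Space n | ((0, star ζ) : (Fin n → ℂ) × Space n) ∈ D} :=
      hD.preimage (by fun_prop)
    have hgd : ∀ ξ : Space n, (0, ξ) ∈ D → DifferentiableAt ℂ g ξ := by
      intro ξ hξ
      have hin : DifferentiableAt ℂ (fun ξ : Space n => ((0, ξ) : (Fin n → ℂ) × Space n)) ξ := by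
        fun_prop
      have d1 : ∀ v, DifferentiableOn ℂ (fun x => fderiv ℂ Q x v) D := fun v =>
        differentiableOn_fderiv_apply hD hQd v
      have d2 : ∀ v w, DifferentiableOn ℂ (fun x => fderiv ℂ (fun x => fderiv ℂ Q x v) x w) D :=
        fun v w => differentiableOn_fderiv_apply hD (d1 v) w
      have hn := hD.mem_nhds hξ
      refine (DifferentiableAt.fun_sum fun j _ => ?_).sub
        ((DifferentiableAt.fun_sum fun i _ => ?_).const_add c)
      · exact (((d2 _ _).differentiableAt hn).comp ξ hin).const_mul _
      · exact (((d1 _).differentiableAt hn).comp ξ hin).const_mul _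
    -- The relation is holomorphic in ζ̄; conjugating its value makes it holomorphic in ζ without
    -- changing its zeros.
    have hG : DifferentiableOn ℂ (star ∘ g ∘ star)
        {ζ : Space n | ((0, star ζ) : (Fin n → ℂ) × Space n) ∈ D} := by
      intro ζ hζ
      have := (hgd (star ζ) hζ).star_star
      rw [star_star] at this
      exact this.differentiableWithinAt
    have h1 := hN.eqOn_zero hNc hU (fun ζ hζ => hmemD ζ (hNS hζ)) hG h0N (by
      rw [eventually_nhdsWithin_iff]
      filter_upwards [hrel] with ζ hζ hζN
      exact star_eq_zero.mpr (sub_eq_zero.mpr (hζ (hNS hζN)))) ζ hζ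
    exact star_eq_zero.mp h1
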